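/- Let $H\in(0,1)$ and, for $T>0$, let $\mathfrak H=\mathfrak H_T$ be the canonical Hilbert space of fractional Brownian motion with Hurst parameter $H$ on $[0,T]$, i.e. the completion of the real step functions on $[0,T]$ for the inner product determined by $$\langle \mathbf 1_{[0,s]},\mathbf 1_{[0,t]}\rangle_{\mathfrak H}=\tfrac12\big(s^{2H}+t^{2H}-|s-t|^{2H}\big),\qquad s,t\in[0,T],$$ and let $\mathfrak H^{\otimes 2}$ be its Hilbert space tensor square. A function $f\in L^2([0,T]^2)$ is regarded as the element $x\in\mathfrak H^{\otimes2}$ if there are step functions $\varphi_n$ (finite linear combinations of the functions $\mathbf 1_{[0,t]\times[0,s]}=\mathbf 1_{[0,t]}\otimes\mathbf 1_{[0,s]}$) with $\varphi_n\to f$ in $L^2([0,T]^2)$ and $\varphi_n\to x$ in $\mathfrak H^{\otimes2}$. Put $$f_T(t,s)=e^{-|t-s|}\,\mathbf 1_{\{0\le s,t\le T\}},\qquad \sigma^2=H^2\,\Gamma(2H)^2\,(4H-1)\Big(1-\frac{1}{\cos(2H\pi)}\Big),$$ where for $H=\frac14$ the factor $(4H-1)\big(1-\frac1{\cos(2H\pi)}\big)$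 is read as its limit $\frac2\pi$. Then, for every $T>0$, $f_T$ is a uniquely determined element of $\mathfrak H^{\otimes2}$, and the (finite) limit $$\lim_{T\to\infty}\frac1{2T}\,\|f_T\|^2_{\mathfrak H^{\otimes2}}$$ exists if and only if $H\in(0,\frac34)$; in that case it equals $\sigma^2$. -/

import Mathlib

open Filter Topology MeasureTheory
open scoped TensorProduct

noncomputable section

/-- The Hurst parameter: a number `H ∈ (0, 1)`. -/
abbrev HurstParameter : Type := Set.Ioo (0 : ℝ) 1

/-- The covariance function `R(s, t) = (s^{2H} + t^{2H} - |s - t|^{2H}) / 2` of fractional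
Brownian motion (used for `s, t ≥ 0`). -/
def fbmCov (H s t : ℝ) : ℝ :=
  (1 / 2) * (s ^ (2 * H) + t ^ (2 * H) - |s - t| ^ (2 * H))

/-! The covariance function is positive semidefinite. This is needed to have an inner product on
step functions; the proof is by the spectral representation of `|x|^{2H}`. -/

theorem fbm_integrable_one (a : ℝ) (ha : a ∈ Set.Ioo (0 : ℝ) 2) :
    IntegrableOn (fun ξ : ℝ => (1 - Real.cos ξ) * ξ ^ (-1 - a)) (Set.Ioi 0) := by
  obtain ⟨h0, h2⟩ := ha
  have hm : Measurable (fun ξ : ℝ => (1 - Real.cos ξ) * ξ ^ (-1 - a)) := by fun_prop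
  rw [← Set.Ioc_union_Ioi_eq_Ioi (zero_le_one (α := ℝ))]
  refine IntegrableOn.union ?_ ?_
  · have h1 : IntegrableOn (fun ξ : ℝ => ξ ^ (1 - a)) (Set.Ioc 0 1) := by
      rw [← intervalIntegrable_iff_integrableOn_Ioc_of_le zero_le_one]
      exact intervalIntegral.intervalIntegrable_rpow' (by linarith)
    refine Integrable.mono' h1 hm.aestronglyMeasurable ?_
    refine (ae_restrict_mem measurableSet_Ioc).mono fun ξ hξ => ?_
    have hp : (0 : ℝ) < ξ := hξ.1
    have hc := Real.one_sub_sq_div_two_le_cos (x := ξ)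
    have hc1 := Real.cos_le_one ξ
    have hr : (0 : ℝ) < ξ ^ (-1 - a) := Real.rpow_pos_of_pos hp _
    rw [Real.norm_of_nonneg (mul_nonneg (by linarith) hr.le)]
    have h3 : ξ ^ (1 - a) = ξ ^ 2 * ξ ^ (-1 - a) := by
      rw [← Real.rpow_natCast, ← Real.rpow_add hp]
      congr 1
      push_cast
      ring
    rw [h3]
    refine mul_le_mul_of_nonneg_right ?_ hr.le
    nlinarith [sq_nonneg ξ]
  · have h1 : IntegrableOn (fun ξ : ℝ => 2 * ξ ^ (-1 - a)) (Set.Ioi 1) :=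
      (integrableOn_Ioi_rpow_of_lt (by linarith) zero_lt_one).const_mul 2
    refine Integrable.mono' h1 hm.aestronglyMeasurable ?_
    refine (ae_restrict_mem measurableSet_Ioi).mono fun ξ hξ => ?_
    have hp : (0 : ℝ) < ξ := zero_lt_one.trans hξ
    have hc1 := Real.cos_le_one ξ
    have hc2 := Real.neg_one_le_cos ξ
    have hr : (0 : ℝ) < ξ ^ (-1 - a) := Real.rpow_pos_of_pos hp _
    rw [Real.norm_of_nonneg (mul_nonneg (by linarith) hr.le)]
    exact mul_le_mul_of_nonneg_right (by linarith) hr.le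

/-- Scaling: the integrand with `cos (x ξ)`, up to a constant factor, is a dilation. -/
theorem fbm_dilate (a x : ℝ) (hx : 0 < x) (ξ : ℝ) (hξ : ξ ∈ Set.Ioi (0 : ℝ)) :
    (1 - Real.cos (x * ξ)) * ξ ^ (-1 - a) =
      x ^ (1 + a) * ((1 - Real.cos (x * ξ)) * (x * ξ) ^ (-1 - a)) := by
  have hξ' : (0 : ℝ) < ξ := hξ
  have h : x ^ (1 + a) * x ^ (-1 - a) = 1 := by
    rw [← Real.rpow_add hx]
    simp
  rw [Real.mul_rpow hx.le hξ'.le]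
  linear_combination (-(1 - Real.cos (x * ξ)) * ξ ^ (-1 - a)) * h

theorem fbm_integrable (a : ℝ) (ha : a ∈ Set.Ioo (0 : ℝ) 2) (x : ℝ) :
    IntegrableOn (fun ξ : ℝ => (1 - Real.cos (x * ξ)) * ξ ^ (-1 - a)) (Set.Ioi 0) := by
  have key : ∀ y : ℝ, 0 < y →
      IntegrableOn (fun ξ : ℝ => (1 - Real.cos (y * ξ)) * ξ ^ (-1 - a)) (Set.Ioi 0) := by
    intro y hy
    rw [integrableOn_congr_fun (fun ξ hξ => fbm_dilate a y hy ξ hξ) measurableSet_Ioi]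
    refine Integrable.const_mul ?_ _
    have := (integrableOn_Ioi_comp_mul_left_iff
      (fun ξ : ℝ => (1 - Real.cos ξ) * ξ ^ (-1 - a)) 0 hy).2
      (by simpa using fbm_integrable_one a ha)
    exact this
  rcases lt_trichotomy x 0 with h | h | h
  · have := key (-x) (by linarith)
    simpa [Real.cos_neg] using this
  · simp [h]
  · exact key x h

theorem fbm_integral (a : ℝ) (ha : a ∈ Set.Ioo (0 : ℝ) 2) (x : ℝ) :
    ∫ ξ in Set.Ioi (0 : ℝ), (1 - Real.cos (x * ξ)) * ξ ^ (-1 - a) =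
      |x| ^ a * ∫ ξ in Set.Ioi (0 : ℝ), (1 - Real.cos ξ) * ξ ^ (-1 - a) := by
  have key : ∀ y : ℝ, 0 < y →
      ∫ ξ in Set.Ioi (0 : ℝ), (1 - Real.cos (y * ξ)) * ξ ^ (-1 - a) =
        y ^ a * ∫ ξ in Set.Ioi (0 : ℝ), (1 - Real.cos ξ) * ξ ^ (-1 - a) := by
    intro y hy
    rw [setIntegral_congr_fun measurableSet_Ioi (fun ξ hξ => fbm_dilate a y hy ξ hξ),
      integral_const_mul,
      integral_comp_mul_left_Ioi (fun ξ : ℝ => (1 - Real.cos ξ) * ξ ^ (-1 - a)) 0 hy,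
      mul_zero, smul_eq_mul, ← mul_assoc, add_comm, Real.rpow_add hy, Real.rpow_one,
      mul_assoc (y ^ a), mul_inv_cancel₀ hy.ne', mul_one]
  rcases lt_trichotomy x 0 with h | h | h
  · have := key (-x) (by linarith)
    rw [abs_of_neg h]
    simpa [Real.cos_neg] using this
  · simp [h, Real.zero_rpow ha.1.ne']
  · rw [abs_of_pos h]
    exact key x h

theorem fbm_const_pos (a : ℝ) (ha : a ∈ Set.Ioo (0 : ℝ) 2) :
    0 < ∫ ξ in Set.Ioi (0 : ℝ), (1 - Real.cos ξ) * ξ ^ (-1 - a) := by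
  have hnn : ∀ ξ ∈ Set.Ioi (0 : ℝ), 0 ≤ (1 - Real.cos ξ) * ξ ^ (-1 - a) := fun ξ hξ =>
    mul_nonneg (by linarith [Real.cos_le_one ξ]) (Real.rpow_nonneg (le_of_lt hξ) _)
  rw [setIntegral_pos_iff_support_of_nonneg_ae
    ((ae_restrict_mem measurableSet_Ioi).mono hnn) (fbm_integrable_one a ha)]
  have hsub : Set.Ioo (0 : ℝ) 1 ⊆
      Function.support (fun ξ : ℝ => (1 - Real.cos ξ) * ξ ^ (-1 - a)) ∩ Set.Ioi 0 := by
    intro ξ hξ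
    refine ⟨?_, hξ.1⟩
    have h1 : Real.cos ξ < 1 := by
      have := Real.cos_lt_cos_of_nonneg_of_le_pi (x := 0) (y := ξ) le_rfl
        (by linarith [hξ.2, Real.pi_gt_three]) hξ.1
      simpa using this
    exact mul_ne_zero (by linarith) (Real.rpow_pos_of_pos hξ.1 _).ne'
  exact lt_of_lt_of_le (by simp) (measure_mono hsub)

/-- The covariance function of fractional Brownian motion is positive semidefinite. -/
theorem fbmCov_nonneg (H : HurstParameter) {ι : Type*} (S : Finset ι) (t c : ι → ℝ)
    (ht : ∀ i, 0 ≤ t i) :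
    0 ≤ ∑ i ∈ S, ∑ j ∈ S, c i * c j * fbmCov H (t i) (t j) := by
  set a : ℝ := 2 * (H : ℝ) with ha_def
  have ha : a ∈ Set.Ioo (0 : ℝ) 2 := ⟨by linarith [H.2.1], by linarith [H.2.2]⟩
  set C := ∫ ξ in Set.Ioi (0 : ℝ), (1 - Real.cos ξ) * ξ ^ (-1 - a) with hC
  have hCpos : 0 < C := fbm_const_pos a ha
  let g : ℝ → ℝ → ℝ := fun x ξ => (1 - Real.cos (x * ξ)) * ξ ^ (-1 - a)
  have hg : ∀ x, IntegrableOn (g x) (Set.Ioi 0) := fbm_integrable a ha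
  have hgi : ∀ x, ∫ ξ in Set.Ioi (0 : ℝ), g x ξ = |x| ^ a * C := fbm_integral a ha
  have hR : ∀ i j, c i * c j * fbmCov H (t i) (t j) * C =
      ∫ ξ in Set.Ioi (0 : ℝ),
        c i * c j * (1 / 2) * (g (t i) ξ + g (t j) ξ - g (t i - t j) ξ) := by
    intro i j
    have h1 : ∫ ξ in Set.Ioi (0 : ℝ), (g (t i) ξ + g (t j) ξ - g (t i - t j) ξ) =
        (t i) ^ a * C + (t j) ^ a * C - |t i - t j| ^ a * C := by
      have h2 := integral_sub ((hg (t i)).add (hg (t j))) (hg (t i - t j))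
      have h3 := integral_add (hg (t i)) (hg (t j))
      simp only [Pi.add_apply] at h2
      rw [h2, h3, hgi, hgi, hgi, abs_of_nonneg (ht i), abs_of_nonneg (ht j)]
    rw [integral_const_mul, h1, fbmCov]
    ring
  have hint : ∀ i j, IntegrableOn (fun ξ =>
      c i * c j * (1 / 2) * (g (t i) ξ + g (t j) ξ - g (t i - t j) ξ)) (Set.Ioi 0) :=
    fun i j => (((hg _).add (hg _)).sub (hg _)).const_mul _
  have hsum : (∑ i ∈ S, ∑ j ∈ S, c i * c j * fbmCov H (t i) (t j)) * C =
      ∫ ξ in Set.Ioi (0 : ℝ), ∑ i ∈ S, ∑ j ∈ S,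
        c i * c j * (1 / 2) * (g (t i) ξ + g (t j) ξ - g (t i - t j) ξ) := by
    rw [integral_finsetSum _ fun i _ => integrable_finsetSum _ fun j _ => hint i j,
      Finset.sum_mul]
    refine Finset.sum_congr rfl fun i _ => ?_
    rw [integral_finsetSum _ fun j _ => hint i j, Finset.sum_mul]
    exact Finset.sum_congr rfl fun j _ => hR i j
  have hpos : 0 ≤ ∫ ξ in Set.Ioi (0 : ℝ), ∑ i ∈ S, ∑ j ∈ S,
        c i * c j * (1 / 2) * (g (t i) ξ + g (t j) ξ - g (t i - t j) ξ) := by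
    refine setIntegral_nonneg measurableSet_Ioi fun ξ hξ => ?_
    have hr : (0 : ℝ) ≤ ξ ^ (-1 - a) := Real.rpow_nonneg (le_of_lt hξ) _
    have : (∑ i ∈ S, ∑ j ∈ S,
        c i * c j * (1 / 2) * (g (t i) ξ + g (t j) ξ - g (t i - t j) ξ)) =
        (1 / 2) * ξ ^ (-1 - a) * ((∑ i ∈ S, c i * (1 - Real.cos (t i * ξ))) ^ 2 +
          (∑ i ∈ S, c i * Real.sin (t i * ξ)) ^ 2) := by
      rw [sq, sq, Finset.sum_mul_sum, Finset.sum_mul_sum, ← Finset.sum_add_distrib,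
        Finset.mul_sum]
      refine Finset.sum_congr rfl fun i _ => ?_
      rw [← Finset.sum_add_distrib, Finset.mul_sum]
      refine Finset.sum_congr rfl fun j _ => ?_
      simp only [g, sub_mul (t i), Real.cos_sub]
      ring
    rw [this]
    positivity
  rw [← hsum] at hpos
  exact nonneg_of_mul_nonneg_left hpos hCpos

/-- The bilinear form on finite linear combinations of the indicator functions `1_{[0,t]}`,
`t ∈ [0, T]`, with `⟨1_{[0,s]}, 1_{[0,t]}⟩ = R(s, t)`. -/
def fbmForm (H : ℝ) {T : ℝ} (φ ψ : Set.Icc (0 : ℝ) T →₀ ℝ) : ℝ :=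
  φ.sum fun s a => ψ.sum fun t b => a * b * fbmCov H s t

theorem fbmForm_symm (H : ℝ) {T : ℝ} (φ ψ : Set.Icc (0 : ℝ) T →₀ ℝ) :
    fbmForm H ψ φ = fbmForm H φ ψ := by
  unfold fbmForm Finsupp.sum
  rw [Finset.sum_comm]
  refine Finset.sum_congr rfl fun s _ => Finset.sum_congr rfl fun t _ => ?_
  simp only [fbmCov]
  rw [abs_sub_comm (t : ℝ) s]
  ring

theorem fbmForm_add_left (H : ℝ) {T : ℝ} (φ₁ φ₂ ψ : Set.Icc (0 : ℝ) T →₀ ℝ) :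
    fbmForm H (φ₁ + φ₂) ψ = fbmForm H φ₁ ψ + fbmForm H φ₂ ψ := by
  refine Finsupp.sum_add_index' (fun s => by simp) fun s a b => ?_
  rw [← Finsupp.sum_add]
  exact Finsupp.sum_congr fun t _ => by ring

theorem fbmForm_smul_left (H : ℝ) {T : ℝ} (r : ℝ) (φ ψ : Set.Icc (0 : ℝ) T →₀ ℝ) :
    fbmForm H (r • φ) ψ = r * fbmForm H φ ψ := by
  unfold fbmForm
  rw [Finsupp.sum_smul_index' (fun s => by simp), Finsupp.mul_sum]
  refine Finsupp.sum_congr fun s _ => ?_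
  rw [Finsupp.mul_sum]
  refine Finsupp.sum_congr fun t _ => ?_
  rw [smul_eq_mul]
  ring

/-- Step functions on `[0, T]`, as finite real linear combinations of the indicator functions
`1_{[0,t]}`, `t ∈ [0, T]`: the coefficient of `1_{[0,t]}` in `φ` is `φ t`. (These indicator
functions are linearly independent.) -/
def FbmStep (_H : HurstParameter) (T : ℝ) : Type := Set.Icc (0 : ℝ) T →₀ ℝ

namespace FbmStep

variable {H : HurstParameter} {T : ℝ}

instance : AddCommGroup (FbmStep H T) :=
  inferInstanceAs (AddCommGroup (Set.Icc (0 : ℝ) T →₀ ℝ))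

instance : Module ℝ (FbmStep H T) :=
  inferInstanceAs (Module ℝ (Set.Icc (0 : ℝ) T →₀ ℝ))

/-- The indicator function `1_{[0,t]}`. -/
def ind (H : HurstParameter) {T : ℝ} (t : Set.Icc (0 : ℝ) T) : FbmStep H T :=
  (Finsupp.single t 1 : Set.Icc (0 : ℝ) T →₀ ℝ)

/-- The inner product on step functions with `⟨1_{[0,s]}, 1_{[0,t]}⟩ = R(s, t)`. -/
abbrev preInnerCore (H : HurstParameter) (T : ℝ) :
    PreInnerProductSpace.Core ℝ (FbmStep H T) where
  inner φ ψ := fbmForm (T := T) H φ ψ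
  conj_inner_symm φ ψ := fbmForm_symm (T := T) H φ ψ
  re_inner_nonneg φ :=
    fbmCov_nonneg H (Finsupp.support (α := Set.Icc (0 : ℝ) T) φ)
      (fun s : Set.Icc (0 : ℝ) T => (s : ℝ)) _ fun s => s.2.1
  add_left φ₁ φ₂ ψ := fbmForm_add_left (T := T) H φ₁ φ₂ ψ
  smul_left φ ψ r := fbmForm_smul_left (T := T) H r φ ψ

instance : SeminormedAddCommGroup (FbmStep H T) :=
  InnerProductSpace.Core.toSeminormedAddCommGroup (𝕜 := ℝ) (c := preInnerCore H T)

instance : InnerProductSpace ℝ (FbmStep H T) := InnerProductSpace.ofCore (preInnerCore H T)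

theorem inner_ind (s t : Set.Icc (0 : ℝ) T) :
    inner ℝ (ind H s) (ind H t) = fbmCov H s t := by
  change fbmForm (T := T) H (Finsupp.single s 1) (Finsupp.single t 1) = _
  unfold fbmForm
  rw [Finsupp.sum_single_index (by simp), Finsupp.sum_single_index (by simp)]
  ring

end FbmStep

/-- The canonical Hilbert space `𝔥` of fractional Brownian motion on `[0, T]`: the completion of
the step functions for the inner product with `⟨1_{[0,s]}, 1_{[0,t]}⟩ = R(s, t)`. -/
abbrev FbmHilbert (H : HurstParameter) (T : ℝ) : Type :=
  UniformSpace.Completion (FbmStep H T)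

/-- The Hilbert space tensor square `𝔥 ⊗ 𝔥`: the completion of the algebraic tensor product for
the inner product with `⟨x ⊗ y, x' ⊗ y'⟩ = ⟨x, x'⟩ ⟨y, y'⟩`. -/
abbrev FbmTensorSq (H : HurstParameter) (T : ℝ) : Type :=
  UniformSpace.Completion (FbmHilbert H T ⊗[ℝ] FbmHilbert H T)

/-- Step functions of two variables on `[0, T]²`: finite real linear combinations of the indicator
functions `1_{[0,t] × [0,s]}`, the coefficient of which is `φ (t, s)`. -/
abbrev FbmStep₂ (T : ℝ) : Type := Set.Icc (0 : ℝ) T × Set.Icc (0 : ℝ) T →₀ ℝ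

namespace FbmStep₂

/-- The function `ℝ² → ℝ` given by a step function of two variables. -/
def toFun {T : ℝ} (φ : FbmStep₂ T) (z : ℝ × ℝ) : ℝ :=
  φ.sum fun p a => a * (Set.Icc (0 : ℝ) p.1 ×ˢ Set.Icc (0 : ℝ) p.2).indicator 1 z

/-- The element of `𝔥 ⊗ 𝔥` given by a step function of two variables; `1_{[0,t] × [0,s]}` gives
`1_{[0,t]} ⊗ 1_{[0,s]}`. -/
def toTensor (H : HurstParameter) {T : ℝ} (φ : FbmStep₂ T) : FbmTensorSq H T :=
  φ.sum fun p a => a •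
    ((((FbmStep.ind H p.1 : FbmStep H T) : FbmHilbert H T) ⊗ₜ[ℝ]
      ((FbmStep.ind H p.2 : FbmStep H T) : FbmHilbert H T) :
        FbmHilbert H T ⊗[ℝ] FbmHilbert H T) : FbmTensorSq H T)

end FbmStep₂

/-- The element `x` of `𝔥 ⊗ 𝔥` is the square integrable function `f` on `[0, T]²`: some sequence of
step functions tends to `f` in `L²([0, T]²)` and to `x` in `𝔥 ⊗ 𝔥`. -/
def IsFbmTensor {H : HurstParameter} {T : ℝ} (x : FbmTensorSq H T) (f : ℝ × ℝ → ℝ) : Prop :=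
  ∃ φ : ℕ → FbmStep₂ T,
    Tendsto (fun n => eLpNorm (fun z => (φ n).toFun z - f z) 2
      (volume.restrict (Set.Icc (0 : ℝ) T ×ˢ Set.Icc (0 : ℝ) T))) atTop (𝓝 0) ∧
    Tendsto (fun n => (φ n).toTensor H) atTop (𝓝 x)

open Classical in
/-- The norm in `𝔥 ⊗ 𝔥` of a function `f` on `[0, T]²` that lies in `𝔥 ⊗ 𝔥` (and `0` if `f` does
not lie there). -/
def fbmTensorNorm (H : HurstParameter) (T : ℝ) (f : ℝ × ℝ → ℝ) : ℝ :=
  if h : ∃ x : FbmTensorSq H T, IsFbmTensor x f then ‖h.choose‖ else 0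

/-- The function `f_T(t, s) = e^{-|t - s|} 1_{0 ≤ s, t ≤ T}`. -/
def expKernel (T : ℝ) (z : ℝ × ℝ) : ℝ :=
  (Set.Icc (0 : ℝ) T ×ˢ Set.Icc (0 : ℝ) T).indicator (fun w => Real.exp (-|w.1 - w.2|)) z

/-- `σ_H² = (4H - 1) (1 - 1 / cos (2 H π))`, read as its limit `2 / π` at `H = 1/4`. -/
def sigmaHSq (H : ℝ) : ℝ :=
  if H = 1 / 4 then 2 / Real.pi else (4 * H - 1) * (1 - 1 / Real.cos (2 * H * Real.pi))

/-- `σ² = H² Γ(2H)² σ_H²`. -/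
def sigmaSq (H : ℝ) : ℝ := (H * Real.Gamma (2 * H)) ^ 2 * sigmaHSq H

end

noncomputable section

section


/-! ### Spectral representation of the covariance -/

/-! The spectral map sending $1_{[0,t]}$ to $\sqrt{c}\,|x|^{-1/2-H}(1-e^{itx})$ in $L^2(\mathbb
R;\mathbb C)$ is an isometry (`integral_fbmSpec_mul`), and so is its tensor square on step functions
(`FbmStep₂.eLpNorm_spec`). Uniqueness is then a closability statement: $L^2([0,T]^2)$ convergence to
$0$ forces the spectral functions to $0$ pointwise, and Fatou's lemma turns this into norm
convergence to $0$ (`FbmStep₂.eq_zero_of_tendsto`).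

For existence, put $u_t=1_{[0,t]}-\int_0^t e^{-(t-v)}1_{[0,v]}\,dv$, the element for $s\mapsto
e^{-(t-s)}1_{[0,t]}(s)$. Then $$f_T=u_T\otimes u_T+2\int_0^T u_t\otimes u_t\,dt$$ pointwise
(`integral_ouFun_mul`) and, through Riemann sums, in the tensor square (`isFbmTensor_expTensor`).
The covariance $\rho(t,s)=\langle u_t,u_s\rangle$ is that of an Ornstein-Uhlenbeck process started
at $0$. Hence
$$\|f_T\|^2=\rho(T,T)^2+4\int_0^T\rho(T,t)^2dt+4\int_0^T\!\!\int_0^T\rho(t,s)^2\,ds\,dt.$$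

The difference between $\rho(t,s)$ and the stationary covariance $r(t-s)$ decays exponentially in
$t$ or $s$. Since $r$ vanishes at infinity, $\|f_T\|^2/(2T)$ differs from $\frac2T\int_0^T\!\int_0^T
r(t-s)^2$ by $o(1)$ (`tendsto_ouNormSq_sub`), and these averages tend to $2\int r^2$ when $r^2$ is
integrable and are unbounded otherwise. As $r$ is the Fourier transform of $c\,|x|^{1-2H}/(1+x^2)$,
Plancherel makes $r\in L^2$ equivalent to integrability of $|x|^{2-4H}$ at $0$, that is $H<\frac34$.
The value of $2\int r^2$ follows from Beta integrals and the reflection formula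
(`two_mul_integral_ouCov_sq`). -/

theorem integrable_comp_abs_of_integrableOn {f : ℝ → ℝ} (hf : IntegrableOn f (Set.Ioi 0)) :
    Integrable (fun x => f |x|) := by
  have hp : IntegrableOn (fun x => f |x|) (Set.Ioi 0) :=
    hf.congr_fun (fun x hx => by simp [abs_of_pos (show (0 : ℝ) < x from hx)]) measurableSet_Ioi
  have hn : IntegrableOn (fun x ↦ f |x|) (Set.Iic 0) := by
    rw [← Measure.map_neg_eq_self (volume : Measure ℝ)]
    let m : MeasurableEmbedding fun x : ℝ => -x := (Homeomorph.neg ℝ).measurableEmbedding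
    rw [m.integrableOn_map_iff]
    simp_rw [Function.comp_def, abs_neg, Set.neg_preimage, Set.neg_Iic, neg_zero]
    exact Iff.mpr integrableOn_Ici_iff_integrableOn_Ioi hp
  rw [← integrableOn_univ, ← Set.Iic_union_Ioi (a := (0 : ℝ))]
  exact hn.union hp

/-- The normalizing constant of the spectral representation over the whole line. -/
def specConst (H : ℝ) : ℝ :=
  1 / (4 * ∫ ξ in Set.Ioi (0 : ℝ), (1 - Real.cos ξ) * ξ ^ (-1 - 2 * H))

/-- The spectral density, up to a constant, of the stationary Ornstein-Uhlenbeck process. -/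
def ouDensity (H x : ℝ) : ℝ := |x| ^ (1 - 2 * H) / (1 + x ^ 2)

/-- The spectral function of `1_{[0,t]}`. -/
def fbmSpec (H t x : ℝ) : ℂ :=
  (√(specConst H * |x| ^ (-1 - 2 * H)) : ℝ) * (1 - Complex.exp (Complex.I * (t * x : ℝ)))

variable (H : HurstParameter)

theorem two_mul_hurst_mem : 2 * (H : ℝ) ∈ Set.Ioo (0 : ℝ) 2 :=
  ⟨by linarith [H.2.1], by linarith [H.2.2]⟩

theorem specConst_pos : 0 < specConst H := by
  have := fbm_const_pos _ (two_mul_hurst_mem H)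
  unfold specConst
  positivity

theorem ouDensity_nonneg (H x : ℝ) : 0 ≤ ouDensity H x := by
  unfold ouDensity
  positivity

theorem measurable_ouDensity (H : ℝ) : Measurable (ouDensity H) := by
  unfold ouDensity
  fun_prop

theorem ouDensity_neg (H x : ℝ) : ouDensity H (-x) = ouDensity H x := by
  simp [ouDensity]

/-- The integrand is dominated by $x^p$ on $(0,1]$ and by $x^{p-2q}$ on $(1,\infty)$. -/
theorem rpow_div_one_add_sq_integrableOn {p : ℝ} {q : ℝ} (hp : -1 < p) (hpq : p < 2 * q - 1)
    (hq : 0 ≤ q) :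
    IntegrableOn (fun x : ℝ => x ^ p / (1 + x ^ 2) ^ q) (Set.Ioi 0) := by
  have hm : Measurable (fun x : ℝ => x ^ p / (1 + x ^ 2) ^ q) := by fun_prop
  rw [← Set.Ioc_union_Ioi_eq_Ioi (zero_le_one (α := ℝ))]
  refine IntegrableOn.union ?_ ?_
  · have h1 : IntegrableOn (fun ξ : ℝ => ξ ^ p) (Set.Ioc 0 1) := by
      rw [← intervalIntegrable_iff_integrableOn_Ioc_of_le zero_le_one]
      exact intervalIntegral.intervalIntegrable_rpow' (by linarith)
    refine Integrable.mono' h1 hm.aestronglyMeasurable ?_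
    refine (ae_restrict_mem measurableSet_Ioc).mono fun ξ hξ => ?_
    have hp : (0 : ℝ) < ξ := hξ.1
    rw [Real.norm_of_nonneg (by positivity)]
    exact div_le_self (by positivity) (Real.one_le_rpow (by nlinarith) hq)
  · have h1 : IntegrableOn (fun ξ : ℝ => ξ ^ (p - 2 * q)) (Set.Ioi 1) :=
      integrableOn_Ioi_rpow_of_lt (by linarith) zero_lt_one
    refine Integrable.mono' h1 hm.aestronglyMeasurable ?_
    refine (ae_restrict_mem measurableSet_Ioi).mono fun ξ hξ => ?_
    have hp : (0 : ℝ) < ξ := zero_lt_one.trans hξ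
    rw [Real.norm_of_nonneg (by positivity), Real.rpow_sub hp]
    refine div_le_div_of_nonneg_left (by positivity) (by positivity) ?_
    rw [Real.rpow_mul hp.le]
    refine Real.rpow_le_rpow (by positivity) ?_ hq
    simp

theorem ouDensity_integrable : Integrable (ouDensity H) := by
  have h := rpow_div_one_add_sq_integrableOn (p := 1 - 2 * (H : ℝ)) (q := 1)
    (by linarith [H.2.2]) (by linarith [H.2.1]) zero_le_one
  refine (integrable_comp_abs_of_integrableOn h).congr (ae_of_all _ fun x => ?_)
  simp [ouDensity]

theorem measurable_fbmSpec (H : ℝ) : Measurable (fun z : ℝ × ℝ => fbmSpec H z.1 z.2) := by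
  unfold fbmSpec
  fun_prop

theorem measurable_fbmSpec_right (H t : ℝ) : Measurable (fbmSpec H t) :=
  (measurable_fbmSpec H).comp measurable_prodMk_left

/-- Adds the two bounds $|1-e^{itx}|\le 2$, used for large $x$, and $|1-e^{itx}|\le|tx|$, used for
small $x$. -/
theorem norm_one_sub_exp_sq_le (t x : ℝ) :
    ‖1 - Complex.exp (Complex.I * (t * x : ℝ))‖ ^ 2 * (1 + x ^ 2) ≤ (4 + t ^ 2) * x ^ 2 := by
  set y := ‖1 - Complex.exp (Complex.I * (t * x : ℝ))‖ with hy
  have h0 : 0 ≤ y := norm_nonneg _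
  have h1 : y ≤ |t * x| := by
    rw [hy, norm_sub_rev]
    exact Real.norm_exp_I_mul_ofReal_sub_one_le
  have h2 : y ≤ 2 := by
    refine (norm_sub_le _ _).trans ?_
    rw [mul_comm, Complex.norm_exp_ofReal_mul_I]
    norm_num
  have h3 : y ^ 2 ≤ (t * x) ^ 2 := by
    rw [← sq_abs (t * x)]
    gcongr
  have h4 : y ^ 2 ≤ 4 := by nlinarith
  nlinarith [sq_nonneg x]

/-- One integrable function dominates all spectral functions with $t$ in a bounded interval; besides
square integrability this serves the later use of Fubini's theorem. -/
theorem norm_fbmSpec_sq_le (t x : ℝ) :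
    ‖fbmSpec H t x‖ ^ 2 ≤ (4 + t ^ 2) * specConst H * ouDensity H x := by
  have hc := specConst_pos H
  rcases eq_or_ne x 0 with rfl | hx
  · have : fbmSpec H t 0 = 0 := by simp [fbmSpec]
    rw [this]
    have := ouDensity_nonneg H 0
    simp only [norm_zero, ne_eq, OfNat.ofNat_ne_zero, not_false_eq_true, zero_pow]
    positivity
  · have hx' : 0 < |x| := abs_pos.2 hx
    have h := norm_one_sub_exp_sq_le t x
    rw [fbmSpec, norm_mul, Complex.norm_real, Real.norm_of_nonneg (Real.sqrt_nonneg _), mul_pow,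
      Real.sq_sqrt (by positivity), ouDensity]
    have h3 : |x| ^ (1 - 2 * (H : ℝ)) = |x| ^ (-1 - 2 * (H : ℝ)) * x ^ 2 := by
      rw [← sq_abs x, ← Real.rpow_natCast, ← Real.rpow_add hx']
      congr 1
      push_cast
      ring
    rw [h3, mul_div_assoc', le_div_iff₀ (by positivity)]
    calc _ = specConst H * |x| ^ (-1 - 2 * (H : ℝ)) *
          (‖1 - Complex.exp (Complex.I * (t * x : ℝ))‖ ^ 2 * (1 + x ^ 2)) := by ring
      _ ≤ specConst H * |x| ^ (-1 - 2 * (H : ℝ)) * ((4 + t ^ 2) * x ^ 2) := by gcongr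
      _ = _ := by ring

theorem memLp_fbmSpec (t : ℝ) : MemLp (fbmSpec H t) 2 := by
  rw [memLp_two_iff_integrable_sq_norm (measurable_fbmSpec_right _ _).aestronglyMeasurable]
  refine ((ouDensity_integrable H).const_mul ((4 + t ^ 2) * specConst H)).mono'
    (by have := measurable_fbmSpec_right H t; fun_prop) (ae_of_all _ fun x => ?_)
  rw [Real.norm_of_nonneg (by positivity)]
  exact norm_fbmSpec_sq_le H t x

theorem integrable_fbmSpec_mul (s t : ℝ) :
    Integrable (fun x => fbmSpec H s x * star (fbmSpec H t x)) :=
  (memLp_fbmSpec H s).integrable_mul (memLp_fbmSpec H t).star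

theorem fbmSpec_neg (H t x : ℝ) : fbmSpec H t (-x) = star (fbmSpec H t x) := by
  simp [fbmSpec, ← Complex.exp_conj]

/-- The real part of $(1-e^{isx})(1-e^{-itx})$ is $(1-\cos sx)+(1-\cos tx)-(1-\cos (s-t)x)$, and
each summand integrates to a power by scaling. The imaginary part vanishes because $x\mapsto -x$
conjugates the integrand. -/
theorem integral_fbmSpec_mul {s t : ℝ} (hs : 0 ≤ s) (ht : 0 ≤ t) :
    ∫ x, fbmSpec H s x * star (fbmSpec H t x) = (fbmCov H s t : ℂ) := by
  have hint := integrable_fbmSpec_mul H s t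
  apply Complex.ext
  · have h1 : ∀ x : ℝ, (fbmSpec H s x * star (fbmSpec H t x)).re =
        specConst H * ((1 - Real.cos (s * |x|)) * |x| ^ (-1 - 2 * (H : ℝ)) +
          (1 - Real.cos (t * |x|)) * |x| ^ (-1 - 2 * (H : ℝ)) -
          (1 - Real.cos ((s - t) * |x|)) * |x| ^ (-1 - 2 * (H : ℝ))) := by
      intro x
      have hc : ∀ u : ℝ, Real.cos (u * |x|) = Real.cos (u * x) := fun u => by
        rcases abs_choice x with h | h <;> rw [h]
        rw [mul_neg, Real.cos_neg]
      have hpos : 0 ≤ specConst H * |x| ^ (-1 - 2 * (H : ℝ)) :=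
        mul_nonneg (specConst_pos H).le (by positivity)
      have hsq := Real.mul_self_sqrt hpos
      rw [hc, hc, hc, sub_mul s t, Real.cos_sub]
      simp only [fbmSpec, mul_comm Complex.I, Complex.exp_mul_I, ← Complex.ofReal_cos,
        ← Complex.ofReal_sin, Complex.star_def, map_mul, map_sub, map_one, map_add,
        Complex.conj_ofReal, Complex.conj_I]
      simp only [Complex.mul_re, Complex.mul_im, Complex.sub_re, Complex.sub_im, Complex.add_re,
        Complex.add_im, Complex.ofReal_re, Complex.ofReal_im, Complex.I_re, Complex.I_im,
        Complex.one_re, Complex.one_im, Complex.neg_re, Complex.neg_im]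
      linear_combination ((1 - Real.cos (s * x)) * (1 - Real.cos (t * x)) +
        Real.sin (s * x) * Real.sin (t * x)) * hsq
    have h2 := integral_re hint
    simp only [RCLike.re_eq_complex_re] at h2
    rw [← h2]
    simp_rw [h1]
    have hg := fbm_integrable _ (two_mul_hurst_mem H)
    have h3 := integral_sub ((hg s).add (hg t)) (hg (s - t))
    have h4 := integral_add (hg s) (hg t)
    simp only [Pi.add_apply] at h3
    rw [integral_const_mul, integral_comp_abs (f := fun x =>
        (1 - Real.cos (s * x)) * x ^ (-1 - 2 * (H : ℝ)) +
          (1 - Real.cos (t * x)) * x ^ (-1 - 2 * (H : ℝ)) -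
          (1 - Real.cos ((s - t) * x)) * x ^ (-1 - 2 * (H : ℝ))), h3, h4,
      fbm_integral _ (two_mul_hurst_mem H), fbm_integral _ (two_mul_hurst_mem H),
      fbm_integral _ (two_mul_hurst_mem H), specConst, Complex.ofReal_re, fbmCov,
      abs_of_nonneg hs, abs_of_nonneg ht]
    have := (fbm_const_pos _ (two_mul_hurst_mem H)).ne'
    field_simp
    ring
  · have h1 : ∫ x, fbmSpec H s x * star (fbmSpec H t x) =
        star (∫ x, fbmSpec H s x * star (fbmSpec H t x)) := by
      refine (integral_neg_eq_self _ _).symm.trans ?_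
      simp_rw [fbmSpec_neg]
      rw [Complex.star_def, ← integral_conj]
      simp
    have h2 := congrArg Complex.im h1
    simp only [Complex.star_def, Complex.conj_im] at h2
    rw [Complex.ofReal_im]
    simp only [Complex.star_def]
    linarith

end

/-! ### A function determines at most one element of the tensor square -/

namespace FbmStep₂

variable {T : ℝ}

/-- The spectral function of a step function of two variables. -/
def spec (H : ℝ) (φ : FbmStep₂ T) (z : ℝ × ℝ) : ℂ :=
  φ.sum fun p a => (a : ℂ) * (fbmSpec H p.1 z.1 * fbmSpec H p.2 z.2)

theorem toFun_add (φ ψ : FbmStep₂ T) (z : ℝ × ℝ) :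
    (φ + ψ).toFun z = φ.toFun z + ψ.toFun z :=
  Finsupp.sum_add_index' (fun _ => by simp) fun _ _ _ => by ring

theorem toFun_smul (c : ℝ) (φ : FbmStep₂ T) (z : ℝ × ℝ) :
    (c • φ).toFun z = c * φ.toFun z := by
  unfold toFun
  rw [Finsupp.sum_smul_index' (fun _ => by simp), Finsupp.mul_sum]
  exact Finsupp.sum_congr fun _ _ => by rw [smul_eq_mul, mul_assoc]

theorem toFun_sub (φ ψ : FbmStep₂ T) (z : ℝ × ℝ) :
    (φ - ψ).toFun z = φ.toFun z - ψ.toFun z :=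
  Finsupp.sum_sub_index fun _ _ _ => by ring

theorem toTensor_add (H : HurstParameter) (φ ψ : FbmStep₂ T) :
    (φ + ψ).toTensor H = φ.toTensor H + ψ.toTensor H :=
  Finsupp.sum_add_index' (fun _ => zero_smul _ _) fun _ _ _ => add_smul _ _ _

theorem toTensor_smul (H : HurstParameter) (c : ℝ) (φ : FbmStep₂ T) :
    (c • φ).toTensor H = c • φ.toTensor H := by
  unfold toTensor
  refine (Finsupp.sum_smul_index' (h := fun (p : Set.Icc (0 : ℝ) T × Set.Icc (0 : ℝ) T) (a : ℝ) =>
    a • ((((FbmStep.ind H p.1 : FbmStep H T) : FbmHilbert H T) ⊗ₜ[ℝ]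
      ((FbmStep.ind H p.2 : FbmStep H T) : FbmHilbert H T) :
        FbmHilbert H T ⊗[ℝ] FbmHilbert H T) : FbmTensorSq H T)) fun _ => zero_smul ℝ _).trans ?_
  rw [Finsupp.smul_sum]
  exact Finsupp.sum_congr fun _ _ => by rw [smul_eq_mul, mul_smul]

theorem toTensor_sub (H : HurstParameter) (φ ψ : FbmStep₂ T) :
    (φ - ψ).toTensor H = φ.toTensor H - ψ.toTensor H :=
  Finsupp.sum_sub_index fun _ _ _ => sub_smul _ _ _

theorem spec_sub (H : ℝ) (φ ψ : FbmStep₂ T) (z : ℝ × ℝ) :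
    (φ - ψ).spec H z = φ.spec H z - ψ.spec H z :=
  Finsupp.sum_sub_index fun _ _ _ => by push_cast; ring

theorem measurable_toFun (φ : FbmStep₂ T) : Measurable φ.toFun := by
  unfold toFun Finsupp.sum
  refine Finset.measurable_sum _ fun p _ => Measurable.const_mul ?_ _
  exact measurable_one.indicator (measurableSet_Icc.prod measurableSet_Icc)

theorem memLp_spec (H : HurstParameter) (φ : FbmStep₂ T) : MemLp (φ.spec H) 2 := by
  unfold spec Finsupp.sum
  refine memLp_finsetSum _ fun p _ => MemLp.const_mul ?_ _
  rw [memLp_two_iff_integrable_sq_norm]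
  · simp_rw [norm_mul, mul_pow]
    exact ((memLp_fbmSpec H _).integrable_norm_pow two_ne_zero).mul_prod
      ((memLp_fbmSpec H _).integrable_norm_pow two_ne_zero)
  · exact (((measurable_fbmSpec_right _ _).comp measurable_fst).mul
      ((measurable_fbmSpec_right _ _).comp measurable_snd)).aestronglyMeasurable

theorem inner_toTensor (H : HurstParameter) (φ ψ : FbmStep₂ T) :
    inner ℝ (φ.toTensor H) (ψ.toTensor H) = φ.sum fun p a => ψ.sum fun q b =>
      a * b * (fbmCov H p.1 q.1 * fbmCov H p.2 q.2) := by
  unfold toTensor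
  rw [Finsupp.sum_inner]
  refine Finsupp.sum_congr fun p _ => ?_
  rw [Finsupp.inner_sum, Finsupp.sum, Finsupp.sum]
  refine Finset.sum_congr rfl fun q _ => ?_
  rw [real_inner_smul_left, real_inner_smul_right, UniformSpace.Completion.inner_coe,
    TensorProduct.inner_tmul, UniformSpace.Completion.inner_coe, UniformSpace.Completion.inner_coe,
    FbmStep.inner_ind, FbmStep.inner_ind]
  ring

/-- Expanding $|\cdot|^2$ gives a double sum of products of a function of $z_1$ and a function of
$z_2$; Fubini splits each into two covariances, which matches the double sum for the tensor norm. -/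
theorem eLpNorm_spec (H : HurstParameter) (φ : FbmStep₂ T) :
    eLpNorm (φ.spec H) 2 volume = ENNReal.ofReal ‖φ.toTensor H‖ := by
  rw [(memLp_spec H φ).eLpNorm_eq_integral_rpow_norm two_ne_zero ENNReal.ofNat_ne_top]
  congr 1
  have key : ∫ z, ‖φ.spec H z‖ ^ 2 = ‖φ.toTensor H‖ ^ 2 := by
    apply Complex.ofReal_injective
    rw [← real_inner_self_eq_norm_sq, inner_toTensor, ← integral_complex_ofReal]
    have h1 : ∀ z : ℝ × ℝ, ((‖φ.spec H z‖ ^ 2 : ℝ) : ℂ) =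
        ∑ p ∈ φ.support, ∑ q ∈ φ.support, ((φ p * φ q : ℝ) : ℂ) *
          ((fbmSpec H p.1 z.1 * star (fbmSpec H q.1 z.1)) *
           (fbmSpec H p.2 z.2 * star (fbmSpec H q.2 z.2))) := by
      intro z
      rw [Complex.ofReal_pow, ← Complex.mul_conj', spec, Finsupp.sum, map_sum, Finset.sum_mul_sum]
      refine Finset.sum_congr rfl fun p _ => Finset.sum_congr rfl fun q _ => ?_
      simp only [map_mul, Complex.conj_ofReal, Complex.star_def]
      push_cast
      ring
    simp_rw [h1]
    have hi : ∀ p q : Set.Icc (0 : ℝ) T × Set.Icc (0 : ℝ) T,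
        Integrable (fun z : ℝ × ℝ => ((φ p * φ q : ℝ) : ℂ) *
          ((fbmSpec H p.1 z.1 * star (fbmSpec H q.1 z.1)) *
           (fbmSpec H p.2 z.2 * star (fbmSpec H q.2 z.2)))) := fun p q =>
      ((integrable_fbmSpec_mul H _ _).mul_prod (integrable_fbmSpec_mul H _ _)).const_mul _
    rw [integral_finsetSum _ fun p _ => integrable_finsetSum _ fun q _ => hi p q, Finsupp.sum]
    push_cast
    refine Finset.sum_congr rfl fun p _ => ?_
    rw [integral_finsetSum _ fun q _ => by exact_mod_cast hi p q, Finsupp.sum]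
    push_cast
    refine Finset.sum_congr rfl fun q _ => ?_
    rw [integral_const_mul, Measure.volume_eq_prod,
      integral_prod_mul (fun x => fbmSpec H p.1 x * star (fbmSpec H q.1 x))
        (fun x => fbmSpec H p.2 x * star (fbmSpec H q.2 x)),
      integral_fbmSpec_mul H p.1.2.1 q.1.2.1, integral_fbmSpec_mul H p.2.2.1 q.2.2.1]
  have h2 : ∀ z, ‖φ.spec H z‖ ^ (2 : ENNReal).toReal = ‖φ.spec H z‖ ^ 2 := fun z => by simp
  simp_rw [h2]
  rw [key]
  rw [ENNReal.toReal_ofNat, ← one_div, ← Real.sqrt_eq_rpow, Real.sqrt_sq (norm_nonneg _)]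

end FbmStep₂

/-- The derivative in `t` of the spectral function of `1_{[0,t]}`. -/
def fbmSpecDeriv (H x u : ℝ) : ℂ :=
  (√(specConst H * |x| ^ (-1 - 2 * H)) : ℝ) *
    (-(Complex.I * x) * Complex.exp (Complex.I * x * u))

theorem continuous_fbmSpecDeriv (H x : ℝ) : Continuous (fbmSpecDeriv H x) := by
  unfold fbmSpecDeriv
  fun_prop

theorem norm_fbmSpecDeriv (H x u : ℝ) : ‖fbmSpecDeriv H x u‖ = ‖fbmSpecDeriv H x 0‖ := by
  have : Complex.I * (x : ℂ) * u = (x * u : ℝ) * Complex.I := by push_cast; ring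
  rw [fbmSpecDeriv, fbmSpecDeriv, this]
  simp only [norm_mul, Complex.norm_exp_ofReal_mul_I, Complex.ofReal_zero, mul_zero,
    Complex.exp_zero, norm_one]

theorem setIntegral_fbmSpecDeriv (H x : ℝ) {t : ℝ} (ht : 0 ≤ t) :
    ∫ u in Set.Icc 0 t, fbmSpecDeriv H x u = fbmSpec H t x := by
  rw [integral_Icc_eq_integral_Ioc, ← intervalIntegral.integral_of_le ht,
    intervalIntegral.integral_eq_sub_of_hasDerivAt (f := fun u : ℝ => fbmSpec H u x)]
  · simp [fbmSpec]
  · intro u _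
    have h1 : HasDerivAt (fun u : ℝ => Complex.I * x * (u : ℂ)) (Complex.I * x) u := by
      simpa using (Complex.ofRealCLM.hasDerivAt (x := u)).const_mul (Complex.I * x)
    have h2 := (h1.cexp.const_sub 1).const_mul
      ((√(specConst H * |x| ^ (-1 - 2 * H)) : ℝ) : ℂ)
    have h3 : (fun u : ℝ => fbmSpec H u x) = fun u : ℝ =>
        ((√(specConst H * |x| ^ (-1 - 2 * H)) : ℝ) : ℂ) *
          (1 - Complex.exp (Complex.I * x * u)) := by
      ext u
      simp only [fbmSpec]
      push_cast
      ring_nf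
    rw [h3]
    refine h2.congr_deriv ?_
    rw [fbmSpecDeriv]
    ring
  · exact (continuous_fbmSpecDeriv H x).intervalIntegrable _ _

namespace FbmStep₂

variable {T : ℝ}

/-- Since $1-e^{itx}$ is the integral over $[0,t]$ of its derivative in $t$, the spectral function
is the integral of the step function itself against a fixed kernel. This is the link between the
$L^2([0,T]^2)$ topology and the spectral side. -/
theorem spec_eq_setIntegral (H : ℝ) (φ : FbmStep₂ T) (z : ℝ × ℝ) :
    φ.spec H z = ∫ w in Set.Icc (0 : ℝ) T ×ˢ Set.Icc (0 : ℝ) T,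
      (φ.toFun w : ℂ) * (fbmSpecDeriv H z.1 w.1 * fbmSpecDeriv H z.2 w.2) := by
  have hc : Continuous fun w : ℝ × ℝ => fbmSpecDeriv H z.1 w.1 * fbmSpecDeriv H z.2 w.2 :=
    ((continuous_fbmSpecDeriv H _).comp continuous_fst).mul
      ((continuous_fbmSpecDeriv H _).comp continuous_snd)
  have hK : IsCompact (Set.Icc (0 : ℝ) T ×ˢ Set.Icc (0 : ℝ) T) := isCompact_Icc.prod isCompact_Icc
  have hi : ∀ p : Set.Icc (0 : ℝ) T × Set.Icc (0 : ℝ) T, IntegrableOn (fun w : ℝ × ℝ =>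
      (φ p : ℂ) * (Set.Icc (0 : ℝ) p.1 ×ˢ Set.Icc (0 : ℝ) p.2).indicator
        (fun w => fbmSpecDeriv H z.1 w.1 * fbmSpecDeriv H z.2 w.2) w)
      (Set.Icc (0 : ℝ) T ×ˢ Set.Icc (0 : ℝ) T) := fun p =>
    ((hc.continuousOn.integrableOn_compact hK).integrable.indicator
      (measurableSet_Icc.prod measurableSet_Icc)).const_mul _
  have h1 : ∀ w : ℝ × ℝ,
      (φ.toFun w : ℂ) * (fbmSpecDeriv H z.1 w.1 * fbmSpecDeriv H z.2 w.2) =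
      ∑ p ∈ φ.support, (φ p : ℂ) * (Set.Icc (0 : ℝ) p.1 ×ˢ Set.Icc (0 : ℝ) p.2).indicator
        (fun w => fbmSpecDeriv H z.1 w.1 * fbmSpecDeriv H z.2 w.2) w := by
    intro w
    rw [toFun, Finsupp.sum, Complex.ofReal_sum, Finset.sum_mul]
    refine Finset.sum_congr rfl fun p _ => ?_
    by_cases hw : w ∈ Set.Icc (0 : ℝ) p.1 ×ˢ Set.Icc (0 : ℝ) p.2
    · rw [Set.indicator_of_mem hw, Set.indicator_of_mem hw]
      simp
    · rw [Set.indicator_of_notMem hw, Set.indicator_of_notMem hw]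
      simp
  simp_rw [h1]
  rw [integral_finsetSum _ fun p _ => hi p, spec, Finsupp.sum]
  refine Finset.sum_congr rfl fun p _ => ?_
  rw [integral_const_mul, setIntegral_indicator (measurableSet_Icc.prod measurableSet_Icc),
    Set.inter_eq_right.2 (Set.prod_mono (Set.Icc_subset_Icc_right p.1.2.2)
      (Set.Icc_subset_Icc_right p.2.2.2)), Measure.volume_eq_prod, setIntegral_prod_mul,
    setIntegral_fbmSpecDeriv H _ p.1.2.1, setIntegral_fbmSpecDeriv H _ p.2.2.1]

/-- For fixed $z$ the kernel has constant modulus in $w$, and on the finite measure space $[0,T]^2$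
the $L^2$ norm controls the $L^1$ norm. -/
theorem tendsto_spec_zero (H : ℝ) {φ : ℕ → FbmStep₂ T} (z : ℝ × ℝ)
    (h : Tendsto (fun n => eLpNorm (φ n).toFun 2
      (volume.restrict (Set.Icc (0 : ℝ) T ×ˢ Set.Icc (0 : ℝ) T))) atTop (𝓝 0)) :
    Tendsto (fun n => (φ n).spec H z) atTop (𝓝 0) := by
  set K : ℝ := ‖fbmSpecDeriv H z.1 0‖ * ‖fbmSpecDeriv H z.2 0‖ with hK
  set μ := volume.restrict (Set.Icc (0 : ℝ) T ×ˢ Set.Icc (0 : ℝ) T) with hμ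
  have hfin : μ Set.univ ≠ ⊤ := by
    rw [hμ, Measure.restrict_apply_univ]
    exact (isCompact_Icc.prod isCompact_Icc).measure_lt_top.ne
  have hexp : μ Set.univ ^ (1 / (1 : ENNReal).toReal - 1 / (2 : ENNReal).toReal) ≠ ⊤ :=
    ENNReal.rpow_ne_top_of_nonneg (by norm_num) hfin
  have hb : ∀ n, ‖(φ n).spec H z‖ₑ ≤ ENNReal.ofReal K * (eLpNorm (φ n).toFun 2 μ *
      μ Set.univ ^ (1 / (1 : ENNReal).toReal - 1 / (2 : ENNReal).toReal)) := by
    intro n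
    rw [spec_eq_setIntegral]
    refine (enorm_integral_le_lintegral_enorm _).trans ?_
    have h1 : ∀ w : ℝ × ℝ,
        ‖((φ n).toFun w : ℂ) * (fbmSpecDeriv H z.1 w.1 * fbmSpecDeriv H z.2 w.2)‖ₑ =
        ENNReal.ofReal K * ‖(φ n).toFun w‖ₑ := by
      intro w
      rw [← ofReal_norm, norm_mul, norm_mul, norm_fbmSpecDeriv H z.1, norm_fbmSpecDeriv H z.2, ← hK,
        mul_comm, ENNReal.ofReal_mul (by positivity), Complex.norm_real, ofReal_norm]
    simp_rw [h1]
    rw [lintegral_const_mul _ (measurable_toFun _).enorm, ← eLpNorm_one_eq_lintegral_enorm]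
    gcongr
    exact eLpNorm_le_eLpNorm_mul_rpow_measure_univ (by norm_num)
      (measurable_toFun _).aestronglyMeasurable
  rw [tendsto_zero_iff_enorm_tendsto_zero]
  refine tendsto_of_tendsto_of_tendsto_of_le_of_le tendsto_const_nhds ?_ (fun _ => zero_le) hb
  have h2 := ENNReal.Tendsto.const_mul (a := ENNReal.ofReal K)
    (ENNReal.Tendsto.mul_const (b := μ Set.univ ^
      (1 / (1 : ENNReal).toReal - 1 / (2 : ENNReal).toReal)) h (Or.inr hexp))
    (Or.inr ENNReal.ofReal_ne_top)
  simpa using h2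

/-- Closability. With $n$ fixed, the spectral functions of $\varphi_n-\varphi_m$ tend pointwise to
that of $\varphi_n$, so Fatou and the isometry give
$\|\varphi_n\|\le\liminf_m\|\varphi_n-\varphi_m\|=\|\varphi_n-x\|$. Letting $n\to\infty$ yields
$\|x\|\le 0$. -/
theorem eq_zero_of_tendsto (H : HurstParameter) {φ : ℕ → FbmStep₂ T} {x : FbmTensorSq H T}
    (h : Tendsto (fun n => eLpNorm (φ n).toFun 2
      (volume.restrict (Set.Icc (0 : ℝ) T ×ˢ Set.Icc (0 : ℝ) T))) atTop (𝓝 0))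
    (hx : Tendsto (fun n => (φ n).toTensor H) atTop (𝓝 x)) : x = 0 := by
  have hle : ∀ n, ‖(φ n).toTensor H‖ ≤ ‖(φ n).toTensor H - x‖ := by
    intro n
    have h1 := Lp.eLpNorm_lim_le_liminf_eLpNorm (p := 2) (μ := (volume : Measure (ℝ × ℝ)))
      (f := fun m => (φ n - φ m).spec H) (fun m => (memLp_spec H _).1) ((φ n).spec H)
      (ae_of_all _ fun z => by
        simp_rw [spec_sub]
        simpa using tendsto_const_nhds.sub (tendsto_spec_zero H z h))
    simp_rw [eLpNorm_spec, toTensor_sub] at h1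
    have h2 : Tendsto (fun m => ENNReal.ofReal ‖(φ n).toTensor H - (φ m).toTensor H‖) atTop
        (𝓝 (ENNReal.ofReal ‖(φ n).toTensor H - x‖)) :=
      ENNReal.tendsto_ofReal (tendsto_const_nhds.sub hx).norm
    rw [h2.liminf_eq] at h1
    exact (ENNReal.ofReal_le_ofReal_iff (norm_nonneg _)).1 h1
  have h3 := le_of_tendsto_of_tendsto' hx.norm (hx.sub_const x).norm hle
  simpa using h3

end FbmStep₂

theorem IsFbmTensor.unique {H : HurstParameter} {T : ℝ} {x y : FbmTensorSq H T} {f : ℝ × ℝ → ℝ}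
    (hf : AEStronglyMeasurable f (volume.restrict (Set.Icc (0 : ℝ) T ×ˢ Set.Icc (0 : ℝ) T)))
    (hx : IsFbmTensor x f) (hy : IsFbmTensor y f) : x = y := by
  obtain ⟨φ, hφ, hφx⟩ := hx
  obtain ⟨ψ, hψ, hψy⟩ := hy
  refine sub_eq_zero.1 (FbmStep₂.eq_zero_of_tendsto H (φ := fun n => φ n - ψ n) ?_ ?_)
  · have h := hφ.add hψ
    rw [add_zero] at h
    refine tendsto_of_tendsto_of_tendsto_of_le_of_le tendsto_const_nhds h (fun _ => zero_le)
      fun n => ?_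
    have h1 : (φ n - ψ n).toFun = (fun z => (φ n).toFun z - f z) - fun z => (ψ n).toFun z - f z := by
      ext z
      simp [FbmStep₂.toFun_sub]
    dsimp only
    rw [h1]
    exact eLpNorm_sub_le ((FbmStep₂.measurable_toFun _).aestronglyMeasurable.sub hf)
      ((FbmStep₂.measurable_toFun _).aestronglyMeasurable.sub hf) (by norm_num)
  · simp_rw [FbmStep₂.toTensor_sub]
    exact hφx.sub hψy

section


/-! ### The covariance of the Ornstein-Uhlenbeck process -/

/-- The spectral function of `s ↦ e^{-(t - s)} 1_{[0,t]}(s)`. -/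
def ouSpec (H t x : ℝ) : ℂ :=
  (√(specConst H * |x| ^ (-1 - 2 * H)) : ℝ) * ((Complex.exp (-t) -
    Complex.exp (Complex.I * (t * x : ℝ))) * (Complex.I * x / (1 + Complex.I * x)))

/-- The covariance function of the stationary Ornstein-Uhlenbeck process driven by fractional
Brownian motion. -/
def ouCov (H u : ℝ) : ℝ := specConst H * ∫ x, ouDensity H x * Real.cos (u * x)

/-- The covariance of the Ornstein-Uhlenbeck process started at `0`. -/
def ouCovZero (H t s : ℝ) : ℝ :=
  ouCov H (t - s) - Real.exp (-t) * ouCov H s - Real.exp (-s) * ouCov H t +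
    Real.exp (-t) * Real.exp (-s) * ouCov H 0

theorem one_add_I_mul_ne_zero (x : ℝ) : (1 : ℂ) + Complex.I * x ≠ 0 := by
  intro h
  have := congrArg Complex.re h
  simp at this

/-- An explicit antiderivative in $v$. The factor $ix/(1+ix)$ that appears turns the weight
$|x|^{-1-2H}$ into $|x|^{1-2H}/(1+x^2)$ after taking squared moduli. -/
theorem fbmSpec_sub_integral (H t x : ℝ) :
    fbmSpec H t x - ∫ v in (0 : ℝ)..t, (Real.exp (-(t - v)) : ℂ) * fbmSpec H v x =
      ouSpec H t x := by
  have hx := one_add_I_mul_ne_zero x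
  set k : ℂ := ((√(specConst H * |x| ^ (-1 - 2 * H)) : ℝ) : ℂ) with hk
  have hder : ∀ v ∈ Set.uIcc 0 t, HasDerivAt (fun v : ℝ => k * (Complex.exp (v - t) -
      Complex.exp ((1 + Complex.I * x) * v - t) / (1 + Complex.I * x)))
      ((Real.exp (-(t - v)) : ℂ) * fbmSpec H v x) v := by
    intro v _
    have h0 : HasDerivAt (fun v : ℝ => (v : ℂ)) 1 v := Complex.ofRealCLM.hasDerivAt
    have h1 := (h0.sub_const (t : ℂ)).cexp
    have h2 := (((h0.const_mul (1 + Complex.I * x)).sub_const (t : ℂ)).cexp).div_const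
      (1 + Complex.I * x)
    refine ((h1.sub h2).const_mul k).congr_deriv ?_
    rw [fbmSpec, ← hk]
    have e1 : Complex.exp ((1 + Complex.I * x) * v - t) =
        Complex.exp (v - t) * Complex.exp (Complex.I * (v * x : ℝ)) := by
      rw [← Complex.exp_add]
      push_cast
      ring_nf
    rw [e1]
    push_cast
    field_simp
    ring_nf
  have hcont : Continuous fun v : ℝ => (Real.exp (-(t - v)) : ℂ) * fbmSpec H v x := by
    unfold fbmSpec
    fun_prop
  rw [intervalIntegral.integral_eq_sub_of_hasDerivAt hder (hcont.intervalIntegrable _ _),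
    fbmSpec, ouSpec, ← hk]
  have e1 : Complex.exp ((1 + Complex.I * x) * t - t) =
      Complex.exp (Complex.I * (t * x : ℝ)) := by
    push_cast
    ring_nf
  rw [e1]
  push_cast
  rw [sub_self, Complex.exp_zero, mul_zero, zero_sub]
  field_simp
  ring

variable (H : HurstParameter)

/-- Fubini: on $0\le v\le t$ the integrand is dominated by a product of two $L^2$ functions of $x$,
independent of $v$. Allowing a general $B$ lets the same exchange serve both arguments of the inner
product. -/
theorem integral_exp_mul_integral_fbmSpec {t : ℝ} (ht : 0 ≤ t) {B : ℝ → ℂ} (hB : MemLp B 2) :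
    ∫ v in (0 : ℝ)..t, (Real.exp (-(t - v)) : ℂ) * ∫ x, fbmSpec H v x * star (B x) =
      ∫ x, (∫ v in (0 : ℝ)..t, (Real.exp (-(t - v)) : ℂ) * fbmSpec H v x) * star (B x) := by
  have hint : Integrable (Function.uncurry fun v x : ℝ =>
      (Real.exp (-(t - v)) : ℂ) * fbmSpec H v x * star (B x))
      ((volume.restrict (Set.uIoc 0 t)).prod volume) := by
    have hD : MemLp (fun x => √((4 + t ^ 2) * specConst H * ouDensity H x)) 2 := by
      have hm := measurable_ouDensity H
      rw [memLp_two_iff_integrable_sq (by fun_prop)]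
      refine ((ouDensity_integrable H).const_mul ((4 + t ^ 2) * specConst H)).congr
        (ae_of_all _ fun x => ?_)
      have := ouDensity_nonneg H x
      have := specConst_pos H
      dsimp only
      rw [Real.sq_sqrt (by positivity)]
    have hDB : Integrable (fun x => √((4 + t ^ 2) * specConst H * ouDensity H x) * ‖B x‖) :=
      hD.integrable_mul hB.norm
    have : IsFiniteMeasure (volume.restrict (Set.uIoc 0 t)) :=
      ⟨by rw [Measure.restrict_apply_univ]; exact measure_Ioc_lt_top⟩
    refine (hDB.comp_snd (volume.restrict (Set.uIoc 0 t))).mono' ?_ ?_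
    · have h1 : Measurable fun z : ℝ × ℝ => (Real.exp (-(t - z.1)) : ℂ) * fbmSpec H z.1 z.2 := by
        have := measurable_fbmSpec H
        fun_prop
      exact h1.aestronglyMeasurable.mul (hB.1.comp_snd.star)
    · have h2 : ∀ᵐ z : ℝ × ℝ ∂((volume.restrict (Set.uIoc 0 t)).prod volume),
          z.1 ∈ Set.uIoc 0 t :=
        Measure.quasiMeasurePreserving_fst.ae (ae_restrict_mem measurableSet_uIoc)
      filter_upwards [h2] with z hz
      rw [Set.uIoc_of_le ht] at hz
      have h3 := norm_fbmSpec_sq_le H z.1 z.2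
      have h4 : Real.exp (-(t - z.1)) ≤ 1 := Real.exp_le_one_iff.2 (by linarith [hz.2])
      have h5 : ‖fbmSpec H z.1 z.2‖ ≤ √((4 + t ^ 2) * specConst H * ouDensity H z.2) := by
        refine Real.le_sqrt_of_sq_le (h3.trans ?_)
        have := ouDensity_nonneg H z.2
        have := specConst_pos H
        have := hz.1.le
        have := hz.2
        gcongr
      simp only [Function.uncurry, norm_mul, norm_star, Complex.norm_real,
        Real.norm_of_nonneg (Real.exp_nonneg _)]
      gcongr
      calc _ ≤ 1 * ‖fbmSpec H z.1 z.2‖ := by gcongr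
        _ ≤ _ := by rwa [one_mul]
  have h := intervalIntegral_integral_swap hint
  have h1 : ∀ v : ℝ, (Real.exp (-(t - v)) : ℂ) * ∫ x, fbmSpec H v x * star (B x) =
      ∫ x, (Real.exp (-(t - v)) : ℂ) * fbmSpec H v x * star (B x) := fun v => by
    rw [← integral_const_mul]
    simp_rw [mul_assoc]
  simp_rw [h1, h]
  congr 1 with x
  rw [intervalIntegral.integral_mul_const]

theorem memLp_ouSpec {t : ℝ} (ht : 0 ≤ t) : MemLp (ouSpec H t) 2 := by
  have hm : Measurable (ouSpec H t) := by
    unfold ouSpec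
    fun_prop
  rw [memLp_two_iff_integrable_sq_norm hm.aestronglyMeasurable]
  refine ((ouDensity_integrable H).const_mul (4 * specConst H)).mono'
    (by fun_prop) ?_
  filter_upwards [compl_mem_ae_iff.2 (measure_singleton (0 : ℝ))] with x hx
  have hx' : 0 < |x| := abs_pos.2 hx
  have hc := specConst_pos H
  have h1 : ‖Complex.exp (-t) - Complex.exp (Complex.I * (t * x : ℝ))‖ ≤ 2 := by
    refine (norm_sub_le _ _).trans ?_
    rw [mul_comm, Complex.norm_exp_ofReal_mul_I, ← Complex.ofReal_neg, ← Complex.ofReal_exp,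
      Complex.norm_real, Real.norm_of_nonneg (Real.exp_nonneg _)]
    have := Real.exp_le_one_iff.2 (show -t ≤ 0 by linarith)
    linarith
  have h2 : ‖Complex.I * x / (1 + Complex.I * x)‖ ^ 2 = x ^ 2 / (1 + x ^ 2) := by
    rw [norm_div, div_pow, ← Complex.normSq_eq_norm_sq, ← Complex.normSq_eq_norm_sq]
    simp [Complex.normSq_apply, sq]
  have h3 : |x| ^ (1 - 2 * (H : ℝ)) = |x| ^ (-1 - 2 * (H : ℝ)) * x ^ 2 := by
    rw [← sq_abs x, ← Real.rpow_natCast, ← Real.rpow_add hx']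
    congr 1
    push_cast
    ring
  rw [Real.norm_of_nonneg (by positivity), ouSpec, norm_mul, norm_mul, mul_pow, mul_pow, h2,
    Complex.norm_real, Real.norm_of_nonneg (Real.sqrt_nonneg _), Real.sq_sqrt (by positivity),
    ouDensity, h3]
  have h4 : ‖Complex.exp (-t) - Complex.exp (Complex.I * (t * x : ℝ))‖ ^ 2 ≤ 4 := by
    have := norm_nonneg (Complex.exp (-t) - Complex.exp (Complex.I * (t * x : ℝ)))
    nlinarith
  calc _ ≤ specConst H * |x| ^ (-1 - 2 * (H : ℝ)) * (4 * (x ^ 2 / (1 + x ^ 2))) := by gcongr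
    _ = _ := by ring

theorem integrable_ouDensity_mul_exp (u : ℝ) :
    Integrable fun x : ℝ => (ouDensity H x : ℂ) * Complex.exp (Complex.I * (u * x : ℝ)) := by
  refine (ouDensity_integrable H).ofReal.mul_bdd (c := 1)
    (by fun_prop) (ae_of_all _ fun x => ?_)
  rw [mul_comm, Complex.norm_exp_ofReal_mul_I]

theorem specConst_mul_integral_exp (u : ℝ) :
    (specConst H : ℂ) * ∫ x : ℝ, (ouDensity H x : ℂ) * Complex.exp (Complex.I * (u * x : ℝ)) =
      (ouCov H u : ℂ) := by
  rw [ouCov, Complex.ofReal_mul]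
  congr 1
  have hint := integrable_ouDensity_mul_exp H u
  have hc : ∀ x : ℝ, (ouDensity H x : ℂ) * Complex.exp (Complex.I * (u * x : ℝ)) =
      (ouDensity H x * Real.cos (u * x) : ℝ) + (ouDensity H x * Real.sin (u * x) : ℝ) *
        Complex.I := by
    intro x
    rw [mul_comm Complex.I, Complex.exp_mul_I]
    push_cast
    ring
  apply Complex.ext
  · have h := integral_re hint
    simp only [RCLike.re_eq_complex_re] at h
    rw [← h, Complex.ofReal_re]
    congr 1 with x
    rw [hc]
    simp only [Complex.add_re, Complex.ofReal_re, Complex.re_ofReal_mul, Complex.I_re, mul_zero,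
      add_zero]
  · have h := integral_im hint
    simp only [RCLike.im_eq_complex_im] at h
    rw [← h, Complex.ofReal_im]
    have h1 : ∀ x : ℝ, ((ouDensity H x : ℂ) * Complex.exp (Complex.I * (u * x : ℝ))).im =
        ouDensity H x * Real.sin (u * x) := fun x => by
      rw [hc]
      simp only [Complex.add_im, Complex.ofReal_im, Complex.im_ofReal_mul, Complex.I_im, mul_one,
        zero_add]
    simp_rw [h1]
    have h2 := integral_neg_eq_self (fun x => ouDensity H x * Real.sin (u * x)) volume
    simp_rw [ouDensity_neg, mul_neg, Real.sin_neg, mul_neg, integral_neg] at h2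
    linarith

theorem ouCov_neg (H u : ℝ) : ouCov H (-u) = ouCov H u := by
  simp [ouCov]

/-- The product $(e^{-t}-e^{itx})(e^{-s}-e^{-isx})$ has four terms, each a constant times an
exponential in $x$; integrating them against the density gives the four terms of `ouCovZero`. -/
theorem integral_ouSpec_mul {t s : ℝ} :
    ∫ x, ouSpec H t x * star (ouSpec H s x) = (ouCovZero H t s : ℂ) := by
  have hi := integrable_ouDensity_mul_exp H
  have h1 : (fun x => ouSpec H t x * star (ouSpec H s x)) =ᵐ[volume] fun x : ℝ =>
      (specConst H : ℂ) * ((ouDensity H x : ℂ) * Complex.exp (Complex.I * ((t - s) * x : ℝ)) -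
        Complex.exp (-t) * ((ouDensity H x : ℂ) * Complex.exp (Complex.I * (-s * x : ℝ))) -
        Complex.exp (-s) * ((ouDensity H x : ℂ) * Complex.exp (Complex.I * (t * x : ℝ))) +
        Complex.exp (-t) * Complex.exp (-s) *
          ((ouDensity H x : ℂ) * Complex.exp (Complex.I * (0 * x : ℝ)))) := by
    filter_upwards [compl_mem_ae_iff.2 (measure_singleton (0 : ℝ))] with x hx
    have hx' : 0 < |x| := abs_pos.2 hx
    have hc := specConst_pos H
    have h3 : |x| ^ (1 - 2 * (H : ℝ)) = |x| ^ (-1 - 2 * (H : ℝ)) * x ^ 2 := by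
      rw [← sq_abs x, ← Real.rpow_natCast, ← Real.rpow_add hx']
      congr 1
      push_cast
      ring
    have hsq := congrArg (fun y : ℝ => (y : ℂ)) (Real.mul_self_sqrt
      (show 0 ≤ specConst H * |x| ^ (-1 - 2 * (H : ℝ)) by positivity))
    simp only [Complex.ofReal_mul] at hsq
    have h4 : (Complex.I * x / (1 + Complex.I * x)) * (-(Complex.I * x) / (1 + -(Complex.I * x))) =
        ((x ^ 2 / (1 + x ^ 2) : ℝ) : ℂ) := by
      have e1 := one_add_I_mul_ne_zero x
      have e2 : (1 : ℂ) + -(Complex.I * x) ≠ 0 := by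
        have := one_add_I_mul_ne_zero (-x)
        simpa using this
      have e3 : (1 + Complex.I * x) * (1 + -(Complex.I * x)) = (1 : ℂ) + x ^ 2 := by
        linear_combination (-(x : ℂ) ^ 2) * Complex.I_sq
      rw [div_mul_div_comm, e3]
      push_cast
      congr 1
      linear_combination (-(x : ℂ) ^ 2) * Complex.I_sq
    have h5 : star (ouSpec H s x) = (√(specConst H * |x| ^ (-1 - 2 * (H : ℝ))) : ℝ) *
        ((Complex.exp (-s) - Complex.exp (Complex.I * (-s * x : ℝ))) *
          (-(Complex.I * x) / (1 + -(Complex.I * x)))) := by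
      simp [ouSpec, ← Complex.exp_conj]
    have h6 : Complex.exp (Complex.I * ((t - s) * x : ℝ)) =
        Complex.exp (Complex.I * (t * x : ℝ)) * Complex.exp (Complex.I * (-s * x : ℝ)) := by
      rw [← Complex.exp_add]
      push_cast
      ring_nf
    rw [h5, h6, ouSpec, ouDensity, h3]
    calc _ = (((√(specConst H * |x| ^ (-1 - 2 * (H : ℝ))) : ℝ) : ℂ) *
            ((√(specConst H * |x| ^ (-1 - 2 * (H : ℝ))) : ℝ) : ℂ)) *
          ((Complex.I * x / (1 + Complex.I * x)) *
            (-(Complex.I * x) / (1 + -(Complex.I * x)))) *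
          ((Complex.exp (-t) - Complex.exp (Complex.I * (t * x : ℝ))) *
            (Complex.exp (-s) - Complex.exp (Complex.I * (-s * x : ℝ)))) := by ring
      _ = _ := by
        rw [hsq, h4]
        simp only [zero_mul, Complex.ofReal_zero, mul_zero, Complex.exp_zero, Complex.ofReal_mul,
          Complex.ofReal_div]
        ring
  have j1 := hi (t - s)
  have j2 := (hi (-s)).const_mul (Complex.exp (-t))
  have j3 := (hi t).const_mul (Complex.exp (-s))
  have j4 := (hi 0).const_mul (Complex.exp (-t) * Complex.exp (-s))
  have k1 := integral_add ((j1.sub j2).sub j3) j4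
  have k2 := integral_sub (j1.sub j2) j3
  have k3 := integral_sub j1 j2
  simp only [Pi.sub_apply] at k1 k2 k3
  rw [integral_congr_ae h1, integral_const_mul, k1, k2, k3, integral_const_mul, integral_const_mul,
    integral_const_mul]
  have hC : (ouCovZero H t s : ℂ) = ouCov H (t - s) - Complex.exp (-t) * ouCov H s -
      Complex.exp (-s) * ouCov H t + Complex.exp (-t) * Complex.exp (-s) * ouCov H 0 := by
    rw [ouCovZero]
    push_cast
    rfl
  have e := specConst_mul_integral_exp H
  rw [hC, ← e (t - s), ← e t, ← e 0, ← ouCov_neg H s, ← e (-s)]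
  ring

theorem fbmCov_sub_integral {t w : ℝ} (ht : 0 ≤ t) (hw : 0 ≤ w) :
    ((fbmCov H t w - ∫ v in (0 : ℝ)..t, Real.exp (-(t - v)) * fbmCov H v w : ℝ) : ℂ) =
      ∫ x, ouSpec H t x * star (fbmSpec H w x) := by
  have hB := memLp_fbmSpec H w
  have h := integral_exp_mul_integral_fbmSpec H ht hB
  have h1 : ∫ v in (0 : ℝ)..t, (Real.exp (-(t - v)) : ℂ) *
      ∫ x, fbmSpec H v x * star (fbmSpec H w x) =
      ((∫ v in (0 : ℝ)..t, Real.exp (-(t - v)) * fbmCov H v w : ℝ) : ℂ) := by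
    rw [← intervalIntegral.integral_ofReal]
    refine intervalIntegral.integral_congr fun v hv => ?_
    rw [Set.uIcc_of_le ht] at hv
    rw [integral_fbmSpec_mul H hv.1 hw]
    push_cast
    rfl
  have h3 : ∀ x, (∫ v in (0 : ℝ)..t, (Real.exp (-(t - v)) : ℂ) * fbmSpec H v x) =
      fbmSpec H t x - ouSpec H t x := by
    intro x
    rw [← fbmSpec_sub_integral]
    ring
  rw [Complex.ofReal_sub, ← h1, h, ← integral_fbmSpec_mul H ht hw]
  have i2 : Integrable fun x => ouSpec H t x * star (fbmSpec H w x) :=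
    (memLp_ouSpec H ht).integrable_mul hB.star
  simp_rw [h3, sub_mul]
  rw [integral_sub (integrable_fbmSpec_mul H t w) i2]
  ring

/-- The left side is $\langle u_t,u_s\rangle$ expanded by bilinearity. Conjugate symmetry moves the
integration over $w$ to the first slot, where the Fubini lemma applies again. -/
theorem fbmCov_sub_integral_sub_integral {t s : ℝ} (ht : 0 ≤ t) (hs : 0 ≤ s) :
    (fbmCov H t s - ∫ v in (0 : ℝ)..t, Real.exp (-(t - v)) * fbmCov H v s) -
      ∫ w in (0 : ℝ)..s, Real.exp (-(s - w)) *
        (fbmCov H t w - ∫ v in (0 : ℝ)..t, Real.exp (-(t - v)) * fbmCov H v w) =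
      ouCovZero H t s := by
  apply Complex.ofReal_injective
  have hB := memLp_ouSpec H ht
  have hconj : ∀ f g : ℝ → ℂ, ∫ x, f x * star (g x) = star (∫ x, g x * star (f x)) := by
    intro f g
    rw [Complex.star_def, ← integral_conj]
    congr 1 with x
    simp [mul_comm]
  have h := integral_exp_mul_integral_fbmSpec H hs hB
  have h1 : star (∫ w in (0 : ℝ)..s, (Real.exp (-(s - w)) : ℂ) *
      ∫ x, fbmSpec H w x * star (ouSpec H t x)) =
      ((∫ w in (0 : ℝ)..s, Real.exp (-(s - w)) *
        (fbmCov H t w - ∫ v in (0 : ℝ)..t, Real.exp (-(t - v)) * fbmCov H v w) : ℝ) : ℂ) := by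
    rw [← Complex.conj_ofReal, Complex.star_def, ← intervalIntegral.integral_ofReal]
    congr 1
    refine intervalIntegral.integral_congr fun w hw => ?_
    rw [Set.uIcc_of_le hs] at hw
    have h4 := hconj (fbmSpec H w) (ouSpec H t)
    rw [← fbmCov_sub_integral H ht hw.1, Complex.star_def, Complex.conj_ofReal] at h4
    rw [h4]
    push_cast
    rfl
  have h3 : ∀ x, (∫ v in (0 : ℝ)..s, (Real.exp (-(s - v)) : ℂ) * fbmSpec H v x) =
      fbmSpec H s x - ouSpec H s x := by
    intro x
    rw [← fbmSpec_sub_integral]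
    ring
  rw [Complex.ofReal_sub, ← h1, h, fbmCov_sub_integral H ht hs, ← integral_ouSpec_mul]
  have i1 : Integrable fun x => fbmSpec H s x * star (ouSpec H t x) :=
    (memLp_fbmSpec H s).integrable_mul hB.star
  have i2 : Integrable fun x => ouSpec H s x * star (ouSpec H t x) :=
    (memLp_ouSpec H hs).integrable_mul hB.star
  simp_rw [h3, sub_mul]
  rw [integral_sub i1 i2, star_sub, ← hconj, ← hconj]
  ring

end

/-! ### Plancherel's theorem for integrable functions -/

section Plancherel

open FourierTransform SchwartzMap
open scoped ContDiff

theorem integral_fourier_mul_schwartz {f : ℝ → ℂ} (hf : Integrable f) (φ : 𝓢(ℝ, ℂ)) :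
    ∫ x, φ x • 𝓕 f x = ∫ x, (𝓕 φ) x • f x := by
  have h := VectorFourier.integral_fourierIntegral_smul_eq_flip (L := innerₗ ℝ)
    Real.continuous_fourierChar continuous_inner hf
    (φ.integrable (μ := volume))
  rw [flip_innerₗ] at h
  have h1 : ∀ x, (𝓕 φ) x = VectorFourier.fourierIntegral Real.fourierChar volume (innerₗ ℝ) φ x :=
    fun x => by rw [SchwartzMap.fourier_coe]; rfl
  simp_rw [h1]
  rw [show (∫ x, φ x • 𝓕 f x) = ∫ x, 𝓕 f x • φ x by simp_rw [smul_eq_mul, mul_comm]]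
  refine h.trans ?_
  simp_rw [smul_eq_mul, mul_comm]

theorem ae_eq_of_integral_schwartz {f g : ℝ → ℂ} (hf : LocallyIntegrable f)
    (hg : LocallyIntegrable g) (h : ∀ φ : 𝓢(ℝ, ℂ), ∫ x, φ x • f x = ∫ x, φ x • g x) :
    f =ᵐ[volume] g := by
  refine ae_eq_of_integral_contDiff_smul_eq hf hg fun u hu hs => ?_
  have h₂' : HasCompactSupport (Complex.ofRealCLM ∘ u) := hs.comp_left rfl
  have := h (h₂'.toSchwartzMap (Complex.ofRealCLM.contDiff.comp hu))
  simpa using this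

/-- The abstract Fourier transform on $L^2$ and the Fourier integral agree as tempered
distributions: tested against a Schwartz function, both move the transform onto it. -/
theorem fourier_toLp_ae_eq {f : ℝ → ℂ} (hf : Integrable f) (hf2 : MemLp f 2) :
    (𝓕 (hf2.toLp f) : Lp ℂ 2 (volume : Measure ℝ)) =ᵐ[volume] 𝓕 f := by
  have hcont : Continuous (𝓕 f) :=
    VectorFourier.fourierIntegral_continuous Real.continuous_fourierChar continuous_inner hf
  refine ae_eq_of_integral_schwartz ((Lp.memLp _).locallyIntegrable (by norm_num))
    hcont.locallyIntegrable fun φ => ?_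
  rw [integral_fourier_mul_schwartz hf, ← Lp.toTemperedDistribution_apply,
    ← Lp.fourier_toTemperedDistribution_eq, TemperedDistribution.fourier_apply,
    Lp.toTemperedDistribution_apply]
  refine integral_congr_ae ?_
  filter_upwards [hf2.coeFn_toLp] with x hx
  rw [hx]

theorem memLp_fourier {f : ℝ → ℂ} (hf : Integrable f) (hf2 : MemLp f 2) : MemLp (𝓕 f) 2 :=
  (Lp.memLp _).ae_eq (fourier_toLp_ae_eq hf hf2)

theorem integral_norm_fourier_sq {f : ℝ → ℂ} (hf : Integrable f) (hf2 : MemLp f 2) :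
    ∫ x, ‖𝓕 f x‖ ^ 2 = ∫ x, ‖f x‖ ^ 2 := by
  have h := Lp.norm_fourier_eq (hf2.toLp f)
  have h1 : ∀ g : Lp ℂ 2 (volume : Measure ℝ), ‖g‖ ^ 2 = ∫ x, ‖g x‖ ^ 2 := fun g => by
    rw [@norm_sq_eq_re_inner ℂ, L2.inner_def]
    simp_rw [inner_self_eq_norm_sq_to_K]
    have h2 : ∀ x, (((‖g x‖ : ℝ) : ℂ)) ^ 2 = ((‖g x‖ ^ 2 : ℝ) : ℂ) := fun x => by push_cast; rfl
    simp only [Complex.coe_algebraMap, h2, integral_complex_ofReal]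
    simp
  have h2 := congrArg (· ^ 2) h
  simp only [h1] at h2
  rw [integral_congr_ae (g := fun x => ‖(𝓕 (hf2.toLp f) : Lp ℂ 2 (volume : Measure ℝ)) x‖ ^ 2)
    ((fourier_toLp_ae_eq hf hf2).mono fun x hx => by simp only [hx]), h2]
  exact integral_congr_ae (hf2.coeFn_toLp.mono fun x hx => by simp only [hx])

/-- The converse of Plancherel, needed for divergence: $f$ coincides almost everywhere with the
inverse $L^2$ transform of its Fourier integral. -/
theorem memLp_of_memLp_fourier {f : ℝ → ℂ} (hf : Integrable f) (h : MemLp (𝓕 f) 2) :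
    MemLp f 2 := by
  refine (Lp.memLp (𝓕⁻ (h.toLp (𝓕 f)))).ae_eq ?_
  refine ae_eq_of_integral_schwartz ((Lp.memLp _).locallyIntegrable (by norm_num))
    hf.locallyIntegrable fun φ => ?_
  rw [← Lp.toTemperedDistribution_apply, ← Lp.fourierInv_toTemperedDistribution_eq,
    TemperedDistribution.fourierInv_apply, Lp.toTemperedDistribution_apply]
  -- The test function is $\mathcal F^{-1}\varphi$, so that the transform lands on $\varphi$.
  have h1 := integral_fourier_mul_schwartz hf (𝓕⁻ φ)
  rw [fourier_fourierInv_eq] at h1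
  rw [← h1]
  refine integral_congr_ae ?_
  filter_upwards [h.coeFn_toLp] with x hx
  rw [hx]

end Plancherel

/-! ### Decay and square integrability of the stationary covariance -/

section

open FourierTransform

variable (H : HurstParameter)

/-- The $2\pi$ comes from the kernel $e^{-2\pi i xw}$ of the transform; its sign is harmless because
the covariance is even. -/
theorem specConst_mul_fourier (w : ℝ) :
    (specConst H : ℂ) * 𝓕 (fun x => (ouDensity H x : ℂ)) w = ouCov H (2 * Real.pi * w) := by
  rw [← ouCov_neg, ← specConst_mul_integral_exp, Real.fourier_real_eq_integral_exp_smul]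
  congr 2 with x
  rw [smul_eq_mul, mul_comm]
  congr 2
  push_cast
  ring

theorem continuous_ouCov : Continuous (ouCov H) := by
  refine continuous_const.mul (continuous_of_dominated (bound := ouDensity H) (fun u => ?_)
    (fun u => ae_of_all _ fun x => ?_) (ouDensity_integrable H) (ae_of_all _ fun x => ?_))
  · have := measurable_ouDensity H
    fun_prop
  · rw [norm_mul, Real.norm_of_nonneg (ouDensity_nonneg _ _)]
    exact mul_le_of_le_one_right (ouDensity_nonneg _ _) (Real.abs_cos_le_one _)
  · fun_prop

theorem abs_ouCov_le (u : ℝ) : |ouCov H u| ≤ ouCov H 0 := by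
  have hc := specConst_pos H
  rw [ouCov, ouCov, abs_mul, abs_of_pos hc]
  gcongr
  simp only [zero_mul, Real.cos_zero, mul_one]
  rw [← Real.norm_eq_abs]
  refine norm_integral_le_of_norm_le (ouDensity_integrable H) (ae_of_all _ fun x => ?_)
  rw [norm_mul, Real.norm_of_nonneg (ouDensity_nonneg _ _)]
  exact mul_le_of_le_one_right (ouDensity_nonneg _ _) (Real.abs_cos_le_one _)

/-- The Riemann-Lebesgue lemma, valid for every $H$ because the density is always integrable. -/
theorem tendsto_ouCov : Tendsto (ouCov H) atTop (𝓝 0) := by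
  have h1 : Tendsto (fun w : ℝ => (specConst H : ℂ) * 𝓕 (fun x => (ouDensity H x : ℂ)) w) atTop
      (𝓝 0) := by
    simpa using ((Real.zero_at_infty_fourier _).mono_left atTop_le_cocompact).const_mul
      (specConst H : ℂ)
  have h2 : Tendsto (fun u : ℝ => u / (2 * Real.pi)) atTop atTop :=
    tendsto_id.atTop_div_const (by positivity)
  have h3 := (h1.comp h2).norm
  rw [tendsto_zero_iff_norm_tendsto_zero]
  simp only [Function.comp_def, specConst_mul_fourier, Complex.norm_real, norm_zero] at h3
  refine h3.congr fun u => ?_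
  rw [mul_div_cancel₀ _ (by positivity)]

theorem memLp_ouDensity (hH : (H : ℝ) < 3 / 4) : MemLp (ouDensity H) 2 := by
  rw [memLp_two_iff_integrable_sq (measurable_ouDensity H).aestronglyMeasurable]
  have h := rpow_div_one_add_sq_integrableOn (p := 2 - 4 * (H : ℝ)) (q := 2)
    (by linarith [H.2.2]) (by linarith [H.2.1]) zero_le_two
  refine (integrable_comp_abs_of_integrableOn h).congr ?_
  filter_upwards [compl_mem_ae_iff.2 (measure_singleton (0 : ℝ))] with x hx
  have hx' : 0 < |x| := abs_pos.2 hx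
  have e : (|x| ^ (1 - 2 * (H : ℝ))) ^ 2 = |x| ^ (2 - 4 * (H : ℝ)) := by
    rw [← Real.rpow_natCast, ← Real.rpow_mul hx'.le]
    congr 1
    push_cast
    ring
  rw [ouDensity, div_pow, e, sq_abs, Real.rpow_two]

/-- The obstruction is at the origin: the squared density behaves there like $x^{2-4H}$, and
$2-4H\le-1$. -/
theorem not_memLp_ouDensity (hH : 3 / 4 ≤ (H : ℝ)) : ¬ MemLp (ouDensity H) 2 := by
  rw [memLp_two_iff_integrable_sq (measurable_ouDensity H).aestronglyMeasurable]
  intro h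
  have h1 : IntegrableOn (fun x : ℝ => x ^ (2 - 4 * (H : ℝ))) (Set.Ioo 0 1) := by
    -- The constant $4$ bounds $(1+x^2)^2$ on $(0,1)$.
    refine ((h.integrableOn (s := Set.Ioo 0 1)).const_mul 4).mono' (by fun_prop) ?_
    refine (ae_restrict_mem measurableSet_Ioo).mono fun x hx => ?_
    have hx0 : 0 < x := hx.1
    rw [Real.norm_of_nonneg (by positivity), ouDensity, div_pow, abs_of_pos hx0,
      ← Real.rpow_natCast, ← Real.rpow_mul hx0.le, mul_div_assoc', le_div_iff₀ (by positivity)]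
    have e : (1 - 2 * (H : ℝ)) * ((2 : ℕ) : ℝ) = 2 - 4 * (H : ℝ) := by push_cast; ring
    rw [e, mul_comm]
    gcongr
    have : x ^ 2 ≤ 1 := by nlinarith [hx.2]
    nlinarith [sq_nonneg x]
  rw [intervalIntegral.integrableOn_Ioo_rpow_iff one_pos] at h1
  linarith

/-- Up to a nonzero constant and the dilation by $2\pi$, the covariance is the Fourier transform of
the density. -/
theorem integrable_ouCov_sq_iff :
    Integrable (fun u => ouCov H u ^ 2) ↔ MemLp (𝓕 fun x => (ouDensity H x : ℂ)) 2 := by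
  have hcont : Continuous (𝓕 fun x => (ouDensity H x : ℂ)) :=
    VectorFourier.fourierIntegral_continuous Real.continuous_fourierChar continuous_inner
      (ouDensity_integrable H).ofReal
  have hc := specConst_pos H
  rw [memLp_two_iff_integrable_sq_norm hcont.aestronglyMeasurable,
    ← integrable_const_mul_iff (c := specConst H ^ 2) (by simp [hc.ne'])
      (fun w => ‖𝓕 (fun x => (ouDensity H x : ℂ)) w‖ ^ 2),
    ← integrable_comp_mul_left_iff (fun u => ouCov H u ^ 2) (R := 2 * Real.pi) (by positivity)]
  refine integrable_congr (ae_of_all _ fun w => ?_)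
  have h := congrArg (fun z : ℂ => ‖z‖ ^ 2) (specConst_mul_fourier H w)
  simp only [norm_mul, Complex.norm_real, mul_pow, Real.norm_eq_abs, sq_abs] at h
  exact h.symm

theorem integrable_ouCov_sq (hH : (H : ℝ) < 3 / 4) : Integrable fun u => ouCov H u ^ 2 :=
  (integrable_ouCov_sq_iff H).2
    (memLp_fourier (ouDensity_integrable H).ofReal (memLp_ouDensity H hH).ofReal)

theorem not_integrable_ouCov_sq (hH : 3 / 4 ≤ (H : ℝ)) :
    ¬ Integrable fun u => ouCov H u ^ 2 := by
  rw [integrable_ouCov_sq_iff]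
  intro h
  exact not_memLp_ouDensity H hH
    (memLp_of_memLp_fourier (ouDensity_integrable H).ofReal h).re

theorem integral_ouCov_sq (hH : (H : ℝ) < 3 / 4) :
    ∫ u, ouCov H u ^ 2 = 2 * Real.pi * specConst H ^ 2 * ∫ x, ouDensity H x ^ 2 := by
  have h := integral_norm_fourier_sq (ouDensity_integrable H).ofReal (memLp_ouDensity H hH).ofReal
  simp only [RCLike.norm_ofReal, sq_abs] at h
  have h1 := Measure.integral_comp_mul_left (fun u => ouCov H u ^ 2) (2 * Real.pi)
  have h2 : ∀ w : ℝ, ouCov H (2 * Real.pi * w) ^ 2 =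
      specConst H ^ 2 * ‖𝓕 (fun x => (ouDensity H x : ℂ)) w‖ ^ 2 := fun w => by
    have h := congrArg (fun z : ℂ => ‖z‖ ^ 2) (specConst_mul_fourier H w)
    simp only [norm_mul, Complex.norm_real, mul_pow, Real.norm_eq_abs, sq_abs] at h
    exact h.symm
  simp_rw [h2] at h1
  rw [integral_const_mul] at h1
  have h3 : |(2 * Real.pi)⁻¹| = (2 * Real.pi)⁻¹ := abs_of_pos (by positivity)
  rw [h3, smul_eq_mul] at h1
  have h4 : ∫ w, ‖𝓕 (fun x => (ouDensity H x : ℂ)) w‖ ^ 2 = ∫ x, ouDensity H x ^ 2 := h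
  rw [h4] at h1
  rw [mul_assoc, h1]
  field_simp

end

section


/-! ### Evaluation of the constants -/

/-- A Beta integral: write $\Gamma(q)(1+x^2)^{-q}=\int_0^\infty s^{q-1}e^{-(1+x^2)s}\,ds$, exchange
the integrals, then integrate the Gaussian moment in $x$ and the resulting Gamma integral in $s$. -/
theorem integral_rpow_div_one_add_sq_rpow {p q : ℝ} (hp : -1 < p) (hpq : p < 2 * q - 1) :
    ∫ x in Set.Ioi (0 : ℝ), x ^ p / (1 + x ^ 2) ^ q =
      Real.Gamma ((p + 1) / 2) * Real.Gamma (q - (p + 1) / 2) / (2 * Real.Gamma q) := by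
  have hq : 0 < q := by linarith
  have hG := Real.Gamma_pos_of_pos hq
  have hin : ∀ x : ℝ, ∫ s in Set.Ioi (0 : ℝ), x ^ p * (s ^ (q - 1) * Real.exp (-((1 + x ^ 2) * s))) =
      Real.Gamma q * (x ^ p / (1 + x ^ 2) ^ q) := fun x => by
    rw [integral_const_mul, Real.integral_rpow_mul_exp_neg_mul_Ioi hq (by positivity),
      one_div, Real.inv_rpow (by positivity)]
    ring
  have hout : ∀ s ∈ Set.Ioi (0 : ℝ),
      ∫ x in Set.Ioi (0 : ℝ), x ^ p * (s ^ (q - 1) * Real.exp (-((1 + x ^ 2) * s))) =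
      1 / 2 * Real.Gamma ((p + 1) / 2) * (s ^ (q - (p + 1) / 2 - 1) * Real.exp (-(1 * s))) := by
    intro s hs
    have hs' : (0 : ℝ) < s := hs
    have e : ∀ x : ℝ, x ^ p * (s ^ (q - 1) * Real.exp (-((1 + x ^ 2) * s))) =
        s ^ (q - 1) * Real.exp (-s) * (x ^ p * Real.exp (-s * x ^ (2 : ℝ))) := fun x => by
      rw [show -((1 + x ^ 2) * s) = -s + -s * x ^ (2 : ℝ) by rw [Real.rpow_two]; ring, Real.exp_add]
      ring
    simp_rw [e]
    rw [integral_const_mul, integral_rpow_mul_exp_neg_mul_rpow zero_lt_two hp hs',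
      show q - (p + 1) / 2 - 1 = (q - 1) + -(p + 1) / 2 by ring, Real.rpow_add hs', one_mul]
    ring
  have hint : Integrable (Function.uncurry fun x s : ℝ =>
      x ^ p * (s ^ (q - 1) * Real.exp (-((1 + x ^ 2) * s))))
      ((volume.restrict (Set.Ioi 0)).prod (volume.restrict (Set.Ioi 0))) := by
    have hm : Measurable (Function.uncurry fun x s : ℝ =>
        x ^ p * (s ^ (q - 1) * Real.exp (-((1 + x ^ 2) * s)))) := by fun_prop
    rw [integrable_prod_iff hm.aestronglyMeasurable]
    constructor
    · refine ae_of_all _ fun x => ?_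
      simp only [Function.uncurry]
      refine Integrable.const_mul ?_ _
      -- The integral of a non-integrable function is $0$ by convention, so a nonzero value proves
      -- integrability.
      refine Integrable.of_integral_ne_zero ?_
      rw [Real.integral_rpow_mul_exp_neg_mul_Ioi hq (by positivity)]
      positivity
    · refine ((rpow_div_one_add_sq_integrableOn hp hpq hq.le).const_mul (Real.Gamma q)).congr ?_
      refine (ae_restrict_mem measurableSet_Ioi).mono fun x hx => ?_
      have hx' : (0 : ℝ) < x := hx
      dsimp only
      rw [← hin]
      refine setIntegral_congr_fun measurableSet_Ioi fun s hs => ?_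
      have hs' : (0 : ℝ) < s := hs
      simp only [Function.uncurry]
      rw [Real.norm_of_nonneg (by positivity)]
  have h := integral_integral_swap hint
  simp_rw [hin] at h
  rw [setIntegral_congr_fun measurableSet_Ioi hout, integral_const_mul, integral_const_mul,
    Real.integral_rpow_mul_exp_neg_mul_Ioi (by linarith) one_pos] at h
  simp only [div_one, Real.one_rpow, one_mul] at h
  rw [eq_div_iff (by positivity)]
  linear_combination 2 * h

/-- The function `A` is an antiderivative vanishing at infinity; as the integrand is nonnegative,
this gives integrability together with the value $-A(0)$. -/
theorem integral_one_sub_cos_mul_exp {s : ℝ} (hs : 0 < s) :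
    IntegrableOn (fun ξ => (1 - Real.cos ξ) * Real.exp (-(ξ * s))) (Set.Ioi 0) ∧
    ∫ ξ in Set.Ioi (0 : ℝ), (1 - Real.cos ξ) * Real.exp (-(ξ * s)) = 1 / (s * (1 + s ^ 2)) := by
  set A : ℝ → ℝ := fun ξ => Real.exp (-(ξ * s)) *
    (-1 / s - (Real.sin ξ - s * Real.cos ξ) / (1 + s ^ 2)) with hA
  have hd : ∀ ξ ∈ Set.Ici (0 : ℝ),
      HasDerivAt A ((1 - Real.cos ξ) * Real.exp (-(ξ * s))) ξ := by
    intro ξ _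
    have h1 : HasDerivAt (fun ξ => Real.exp (-(ξ * s))) (Real.exp (-(ξ * s)) * (-(1 * s))) ξ :=
      (((hasDerivAt_id ξ).mul_const s).neg).exp
    have h2 : HasDerivAt (fun ξ => -1 / s - (Real.sin ξ - s * Real.cos ξ) / (1 + s ^ 2))
        (-((Real.cos ξ - s * -Real.sin ξ) / (1 + s ^ 2))) ξ :=
      (((Real.hasDerivAt_sin ξ).sub ((Real.hasDerivAt_cos ξ).const_mul s)).div_const _).const_sub _
    refine (h1.mul h2).congr_deriv ?_
    field_simp
    ring
  have hnn : ∀ ξ ∈ Set.Ioi (0 : ℝ), 0 ≤ (1 - Real.cos ξ) * Real.exp (-(ξ * s)) := fun ξ _ =>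
    mul_nonneg (by linarith [Real.cos_le_one ξ]) (Real.exp_nonneg _)
  have hlim : Tendsto A atTop (𝓝 0) := by
    have h1 : Tendsto (fun ξ => Real.exp (-(ξ * s))) atTop (𝓝 0) :=
      Real.tendsto_exp_neg_atTop_nhds_zero.comp (tendsto_id.atTop_mul_const hs)
    refine h1.zero_mul_isBoundedUnder_le ⟨1 / s + (1 + s) / (1 + s ^ 2), ?_⟩
    refine eventually_map.2 (Eventually.of_forall fun ξ => ?_)
    simp only [Function.comp_apply, Real.norm_eq_abs]
    refine (abs_sub _ _).trans (add_le_add ?_ ?_)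
    · rw [abs_div, abs_neg, abs_one, abs_of_pos hs]
    · rw [abs_div, abs_of_pos (show 0 < 1 + s ^ 2 by positivity)]
      gcongr
      refine (abs_sub _ _).trans (add_le_add (Real.abs_sin_le_one _) ?_)
      rw [abs_mul, abs_of_pos hs]
      exact mul_le_of_le_one_right hs.le (Real.abs_cos_le_one _)
  refine ⟨integrableOn_Ioi_deriv_of_nonneg' hd hnn hlim, ?_⟩
  rw [integral_Ioi_of_hasDerivAt_of_nonneg' hd hnn hlim, hA]
  simp
  field_simp
  ring

variable (H : HurstParameter)

/-- Write $\Gamma(1+2H)x^{-1-2H}=\int_0^\infty s^{2H}e^{-xs}\,ds$ and exchange: the Laplace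
transform of $1-\cos$ leaves $\int_0^\infty s^{2H-1}/(1+s^2)\,ds$, equal to
$\frac12\Gamma(H)\Gamma(1-H)$, and reflection finishes. -/
theorem Gamma_mul_fbm_const :
    Real.Gamma (1 + 2 * H) * ∫ ξ in Set.Ioi (0 : ℝ), (1 - Real.cos ξ) * ξ ^ (-1 - 2 * (H : ℝ)) =
      Real.pi / (2 * Real.sin (Real.pi * H)) := by
  have hH0 : 0 < (H : ℝ) := H.2.1
  have hH1 : (H : ℝ) < 1 := H.2.2
  have hq : 0 < 1 + 2 * (H : ℝ) := by linarith
  have hG := Real.Gamma_pos_of_pos hq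
  have hin : ∀ x ∈ Set.Ioi (0 : ℝ), ∫ s in Set.Ioi (0 : ℝ),
      (1 - Real.cos x) * (s ^ (1 + 2 * (H : ℝ) - 1) * Real.exp (-(x * s))) =
      Real.Gamma (1 + 2 * H) * ((1 - Real.cos x) * x ^ (-1 - 2 * (H : ℝ))) := fun x hx => by
    have hx' : (0 : ℝ) < x := hx
    rw [integral_const_mul, Real.integral_rpow_mul_exp_neg_mul_Ioi hq hx', one_div,
      Real.inv_rpow hx'.le, ← Real.rpow_neg hx'.le,
      show -(1 + 2 * (H : ℝ)) = -1 - 2 * (H : ℝ) by ring]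
    ring
  have hout : ∀ s ∈ Set.Ioi (0 : ℝ),
      ∫ x in Set.Ioi (0 : ℝ),
        (1 - Real.cos x) * (s ^ (1 + 2 * (H : ℝ) - 1) * Real.exp (-(x * s))) =
      s ^ (2 * (H : ℝ) - 1) / (1 + s ^ 2) ^ (1 : ℝ) := by
    intro s hs
    have hs' : (0 : ℝ) < s := hs
    have e : ∀ x : ℝ, (1 - Real.cos x) * (s ^ (1 + 2 * (H : ℝ) - 1) * Real.exp (-(x * s))) =
        s ^ (2 * (H : ℝ)) * ((1 - Real.cos x) * Real.exp (-(x * s))) := fun x => by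
      rw [add_sub_cancel_left]
      ring
    simp_rw [e]
    rw [integral_const_mul, (integral_one_sub_cos_mul_exp hs').2, Real.rpow_sub hs', Real.rpow_one,
      Real.rpow_one]
    field_simp
  have hint : Integrable (Function.uncurry fun x s : ℝ =>
      (1 - Real.cos x) * (s ^ (1 + 2 * (H : ℝ) - 1) * Real.exp (-(x * s))))
      ((volume.restrict (Set.Ioi 0)).prod (volume.restrict (Set.Ioi 0))) := by
    have hm : Measurable (Function.uncurry fun x s : ℝ =>
        (1 - Real.cos x) * (s ^ (1 + 2 * (H : ℝ) - 1) * Real.exp (-(x * s)))) := by fun_prop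
    rw [integrable_prod_iff hm.aestronglyMeasurable]
    constructor
    · refine (ae_restrict_mem measurableSet_Ioi).mono fun x hx => ?_
      simp only [Function.uncurry]
      refine Integrable.const_mul ?_ _
      have hx' : (0 : ℝ) < x := hx
      refine Integrable.of_integral_ne_zero ?_
      rw [Real.integral_rpow_mul_exp_neg_mul_Ioi hq hx']
      positivity
    · refine ((fbm_integrable_one _ (two_mul_hurst_mem H)).const_mul
        (Real.Gamma (1 + 2 * H))).congr ?_
      refine (ae_restrict_mem measurableSet_Ioi).mono fun x hx => ?_
      dsimp only
      rw [← hin x hx]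
      refine setIntegral_congr_fun measurableSet_Ioi fun s hs => ?_
      have hs' : (0 : ℝ) < s := hs
      have hx' := sub_nonneg.2 (Real.cos_le_one x)
      simp only [Function.uncurry]
      rw [Real.norm_of_nonneg (by positivity)]
  have h := integral_integral_swap hint
  rw [setIntegral_congr_fun measurableSet_Ioi hin, setIntegral_congr_fun measurableSet_Ioi hout,
    integral_const_mul, integral_rpow_div_one_add_sq_rpow (by linarith) (by linarith)] at h
  rw [h, show (2 * (H : ℝ) - 1 + 1) / 2 = H by ring, Real.Gamma_mul_Gamma_one_sub, Real.Gamma_one]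
  ring

theorem specConst_eq :
    specConst H = Real.Gamma (1 + 2 * H) * Real.sin (Real.pi * H) / (2 * Real.pi) := by
  have h := Gamma_mul_fbm_const H
  have hC := fbm_const_pos _ (two_mul_hurst_mem H)
  have hs : 0 < Real.sin (Real.pi * H) :=
    Real.sin_pos_of_pos_of_lt_pi (mul_pos Real.pi_pos H.2.1)
      (by nlinarith [Real.pi_pos, H.2.2])
  rw [specConst]
  have hpi := Real.pi_pos
  rw [eq_div_iff (by positivity)] at h
  rw [div_eq_div_iff (by positivity) (by positivity)]
  linear_combination -2 * h

theorem integral_ouDensity_sq (hH : (H : ℝ) < 3 / 4) :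
    ∫ x, ouDensity H x ^ 2 =
      Real.Gamma (3 / 2 - 2 * H) * Real.Gamma (1 / 2 + 2 * H) := by
  have h1 : ∫ x, ouDensity H x ^ 2 =
      ∫ x, (fun y : ℝ => y ^ (2 - 4 * (H : ℝ)) / (1 + y ^ 2) ^ (2 : ℝ)) |x| := by
    refine integral_congr_ae ?_
    filter_upwards [compl_mem_ae_iff.2 (measure_singleton (0 : ℝ))] with x hx
    have hx' : 0 < |x| := abs_pos.2 hx
    have e : (|x| ^ (1 - 2 * (H : ℝ))) ^ 2 = |x| ^ (2 - 4 * (H : ℝ)) := by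
      rw [← Real.rpow_natCast, ← Real.rpow_mul hx'.le]
      congr 1
      push_cast
      ring
    rw [ouDensity, div_pow, e, sq_abs, Real.rpow_two]
  rw [h1, integral_comp_abs (f := fun y : ℝ => y ^ (2 - 4 * (H : ℝ)) / (1 + y ^ 2) ^ (2 : ℝ)),
    integral_rpow_div_one_add_sq_rpow (by linarith [H.2.1])
    (by linarith [H.2.1]), Real.Gamma_two, show (2 - 4 * (H : ℝ) + 1) / 2 = 3 / 2 - 2 * H by ring,
    show 2 - (3 / 2 - 2 * (H : ℝ)) = 1 / 2 + 2 * H by ring]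
  ring

/-- The product $\Gamma(\frac32-2H)\Gamma(\frac12+2H)$ equals $(\frac12-2H)\pi/\cos(2H\pi)$ by
reflection when $H\ne\frac14$; the rest is $\sin^2(\pi H)=(1-\cos(2H\pi))/2$. -/
theorem two_mul_integral_ouCov_sq (hH : (H : ℝ) < 3 / 4) :
    2 * ∫ u, ouCov H u ^ 2 = sigmaSq H := by
  have hH0 : 0 < (H : ℝ) := H.2.1
  have hpi := Real.pi_pos
  rw [integral_ouCov_sq H hH, integral_ouDensity_sq H hH, specConst_eq, sigmaSq, sigmaHSq,
    add_comm 1 (2 * (H : ℝ)), Real.Gamma_add_one (by positivity)]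
  have hsin : Real.sin (Real.pi * H) ^ 2 = (1 - Real.cos (2 * H * Real.pi)) / 2 := by
    rw [Real.sin_sq_eq_half_sub]
    ring_nf
  split_ifs with h
  -- At $H=\frac14$ both Gamma factors are $\Gamma(1)$ and no reflection is needed.
  · have hc : Real.cos (2 * H * Real.pi) = 0 := by
      rw [h, ← Real.cos_pi_div_two]
      congr 1
      ring
    rw [hc] at hsin
    have e1 : (3 / 2 - 2 * (H : ℝ)) = 1 := by rw [h]; norm_num
    have e2 : (1 / 2 + 2 * (H : ℝ)) = 1 := by rw [h]; norm_num
    rw [e1, e2, Real.Gamma_one, div_pow, mul_pow _ (Real.sin _), hsin]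
    field_simp
    ring
  · have hc : Real.cos (2 * H * Real.pi) ≠ 0 := by
      rcases lt_or_gt_of_ne h with h' | h'
      · exact (Real.cos_pos_of_mem_Ioo ⟨by nlinarith, by nlinarith⟩).ne'
      · exact (Real.cos_neg_of_pi_div_two_lt_of_lt (by nlinarith) (by nlinarith)).ne
    have e1 : Real.Gamma (3 / 2 - 2 * H) =
        (1 / 2 - 2 * (H : ℝ)) * Real.Gamma (1 / 2 - 2 * H) := by
      rw [← Real.Gamma_add_one (fun h' => h (by linarith))]
      congr 1
      ring
    have e2 := Real.Gamma_mul_Gamma_one_sub (1 / 2 - 2 * (H : ℝ))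
    rw [show 1 - (1 / 2 - 2 * (H : ℝ)) = 1 / 2 + 2 * H by ring,
      show Real.pi * (1 / 2 - 2 * (H : ℝ)) = Real.pi / 2 - 2 * H * Real.pi by ring,
      Real.sin_pi_div_two_sub] at e2
    rw [e1, mul_assoc (1 / 2 - 2 * (H : ℝ)), e2, div_pow, mul_pow _ (Real.sin _), hsin]
    generalize Real.cos (2 * H * Real.pi) = c at hc ⊢
    field_simp
    ring

end

section


/-! ### Averages of squared covariances -/

theorem average_comp_sub {g : ℝ → ℝ} {T : ℝ} (hT : 0 < T) :
    1 / T * ∫ t in (0 : ℝ)..T, ∫ s in (0 : ℝ)..T, g (t - s) =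
      ∫ τ in (0 : ℝ)..1, ∫ u in (T * τ - T)..(T * τ), g u := by
  have h := intervalIntegral.integral_comp_mul_left (a := 0) (b := 1)
    (fun t => ∫ s in (0 : ℝ)..T, g (t - s)) hT.ne'
  rw [mul_zero, mul_one, smul_eq_mul] at h
  rw [one_div, ← h]
  congr 1 with τ
  rw [intervalIntegral.integral_comp_sub_left g, sub_zero]

/-- After the substitution $t=T\tau$ the inner integral runs over $[T\tau-T,T\tau]$, which exhausts
the line for $0<\tau<1$; dominated convergence in $\tau$ with bound $\int g$. -/
theorem tendsto_average_comp_sub {g : ℝ → ℝ} (hg : Integrable g) (hnn : ∀ u, 0 ≤ g u)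
    (hc : Continuous g) :
    Tendsto (fun T : ℝ => 1 / T * ∫ t in (0 : ℝ)..T, ∫ s in (0 : ℝ)..T, g (t - s)) atTop
      (𝓝 (∫ u, g u)) := by
  have h : Tendsto (fun T : ℝ => ∫ τ in (0 : ℝ)..1, ∫ u in (T * τ - T)..(T * τ), g u) atTop
      (𝓝 (∫ _ in (0 : ℝ)..1, ∫ u, g u)) := by
    refine intervalIntegral.tendsto_integral_filter_of_dominated_convergence
      (fun _ => ∫ u, g u) ?_ ?_ intervalIntegrable_const ?_
    · filter_upwards [eventually_gt_atTop 0] with T hT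
      refine Continuous.aestronglyMeasurable ?_
      have h1 : ∀ τ, ∫ u in (T * τ - T)..(T * τ), g u = ∫ s in (0 : ℝ)..T, g (T * τ - s) := by
        intro τ
        rw [intervalIntegral.integral_comp_sub_left g, sub_zero]
      simp_rw [h1]
      exact intervalIntegral.continuous_parametric_intervalIntegral_of_continuous' (by fun_prop) _ _
    · filter_upwards [eventually_gt_atTop 0] with T hT
      refine ae_of_all _ fun τ _ => ?_
      rw [intervalIntegral.integral_of_le (by linarith), Real.norm_of_nonneg
        (integral_nonneg hnn)]
      exact setIntegral_le_integral hg (ae_of_all _ hnn)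
    · have h1 : ∀ᵐ τ : ℝ, τ ≠ 1 := compl_mem_ae_iff.2 (measure_singleton _)
      filter_upwards [h1] with τ hτ1 hτ
      rw [Set.uIoc_of_le zero_le_one] at hτ
      have h2 : τ - 1 < 0 := by linarith [lt_of_le_of_ne hτ.2 hτ1]
      refine intervalIntegral_tendsto_integral hg ?_ (tendsto_id.atTop_mul_const hτ.1)
      have h3 : (fun T : ℝ => T * τ - T) = fun T => T * (τ - 1) := by
        ext T
        ring
      rw [h3]
      exact tendsto_id.atTop_mul_const_of_neg h2
  simp only [intervalIntegral.integral_const, sub_zero, one_smul] at h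
  refine h.congr' ?_
  filter_upwards [eventually_gt_atTop 0] with T hT
  rw [average_comp_sub hT]

/-- For $\tau\in[\frac13,\frac23]$ the window $[T\tau-T,T\tau]$ contains $[-T/3,T/3]$, and this
range of $\tau$ has length $\frac13$. Integrability of $g$ is not assumed, since the bound is used
to derive it by contradiction. -/
theorem integral_le_average_comp_sub {g : ℝ → ℝ} (hnn : ∀ u, 0 ≤ g u) (hc : Continuous g)
    {T : ℝ} (hT : 0 < T) :
    ∫ u in (-(T / 3))..(T / 3), g u ≤
      3 * (1 / T * ∫ t in (0 : ℝ)..T, ∫ s in (0 : ℝ)..T, g (t - s)) := by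
  rw [average_comp_sub hT]
  have hi : ∀ a b, IntervalIntegrable g volume a b := fun a b => hc.intervalIntegrable a b
  have hJc : Continuous fun τ => ∫ u in (T * τ - T)..(T * τ), g u := by
    have h1 : ∀ τ, ∫ u in (T * τ - T)..(T * τ), g u = ∫ s in (0 : ℝ)..T, g (T * τ - s) := by
      intro τ
      rw [intervalIntegral.integral_comp_sub_left g, sub_zero]
    simp_rw [h1]
    exact intervalIntegral.continuous_parametric_intervalIntegral_of_continuous' (by fun_prop) _ _
  have h1 : ∫ τ in (1 / 3 : ℝ)..(2 / 3), ∫ u in (T * τ - T)..(T * τ), g u ≤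
      ∫ τ in (0 : ℝ)..1, ∫ u in (T * τ - T)..(T * τ), g u :=
    intervalIntegral.integral_mono_interval (by norm_num) (by norm_num) (by norm_num)
      (ae_of_all _ fun τ => intervalIntegral.integral_nonneg (by linarith) fun u _ => hnn u)
      (hJc.intervalIntegrable _ _)
  have h2 : ∫ _ in (1 / 3 : ℝ)..(2 / 3), ∫ u in (-(T / 3))..(T / 3), g u ≤
      ∫ τ in (1 / 3 : ℝ)..(2 / 3), ∫ u in (T * τ - T)..(T * τ), g u := by
    refine intervalIntegral.integral_mono_on (by norm_num) intervalIntegrable_const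
      (hJc.intervalIntegrable _ _) fun τ hτ => ?_
    exact intervalIntegral.integral_mono_interval (by nlinarith [hτ.2]) (by linarith)
      (by nlinarith [hτ.1]) (ae_of_all _ hnn) (hi _ _)
  rw [intervalIntegral.integral_const, smul_eq_mul] at h2
  linarith

theorem tendsto_average_zero {g : ℝ → ℝ} {M : ℝ} (hc : Continuous g) (hM : ∀ u, |g u| ≤ M)
    (h0 : Tendsto g atTop (𝓝 0)) :
    Tendsto (fun T : ℝ => 1 / T * ∫ t in (0 : ℝ)..T, g t) atTop (𝓝 0) := by
  have h : Tendsto (fun T : ℝ => ∫ τ in (0 : ℝ)..1, g (T * τ)) atTop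
      (𝓝 (∫ _ in (0 : ℝ)..1, (0 : ℝ))) := by
    refine intervalIntegral.tendsto_integral_filter_of_dominated_convergence
      (fun _ => M) ?_ ?_ intervalIntegrable_const ?_
    · exact Eventually.of_forall fun T => by fun_prop
    · exact Eventually.of_forall fun T => ae_of_all _ fun τ _ => hM _
    · refine ae_of_all _ fun τ hτ => ?_
      rw [Set.uIoc_of_le zero_le_one] at hτ
      exact h0.comp (tendsto_id.atTop_mul_const hτ.1)
  simp only [intervalIntegral.integral_zero] at h
  refine h.congr' ?_
  filter_upwards [eventually_gt_atTop 0] with T hT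
  rw [intervalIntegral.integral_comp_mul_left g hT.ne', mul_zero, mul_one, smul_eq_mul, one_div]

variable (H : HurstParameter)

theorem ouCov_zero_nonneg : 0 ≤ ouCov H 0 := (abs_nonneg _).trans (abs_ouCov_le H 0)

theorem continuous_ouCovZero : Continuous fun z : ℝ × ℝ => ouCovZero H z.1 z.2 := by
  have := continuous_ouCov H
  unfold ouCovZero
  fun_prop

theorem abs_ouCovZero_sub_le (t s : ℝ) :
    |ouCovZero H t s - ouCov H (t - s)| ≤ Real.exp (-t) * |ouCov H s| +
      Real.exp (-s) * |ouCov H t| + Real.exp (-t) * Real.exp (-s) * ouCov H 0 := by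
  have h0 := ouCov_zero_nonneg H
  have e : ouCovZero H t s - ouCov H (t - s) = -(Real.exp (-t) * ouCov H s) +
      -(Real.exp (-s) * ouCov H t) + Real.exp (-t) * Real.exp (-s) * ouCov H 0 := by
    rw [ouCovZero]
    ring
  rw [e]
  refine (abs_add_three _ _ _).trans_eq ?_
  simp only [abs_neg, abs_mul, Real.abs_exp, abs_of_nonneg h0]

theorem abs_ouCovZero_le {t s : ℝ} (ht : 0 ≤ t) (hs : 0 ≤ s) :
    |ouCovZero H t s| ≤ 4 * ouCov H 0 := by
  have h0 := ouCov_zero_nonneg H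
  have h1 := abs_ouCovZero_sub_le H t s
  have h2 := abs_ouCov_le H
  have et : Real.exp (-t) ≤ 1 := Real.exp_le_one_iff.2 (by linarith)
  have es : Real.exp (-s) ≤ 1 := Real.exp_le_one_iff.2 (by linarith)
  have h3 : Real.exp (-t) * |ouCov H s| ≤ 1 * ouCov H 0 := by gcongr; exact h2 s
  have h4 : Real.exp (-s) * |ouCov H t| ≤ 1 * ouCov H 0 := by gcongr; exact h2 t
  have h5 : Real.exp (-t) * Real.exp (-s) * ouCov H 0 ≤ 1 * 1 * ouCov H 0 := by gcongr
  have h6 := abs_sub_abs_le_abs_sub (ouCovZero H t s) (ouCov H (t - s))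
  have h7 := h2 (t - s)
  linarith

/-- Factor the difference of squares; the sum is at most $4r(0)+r(0)$. -/
theorem abs_sq_ouCovZero_sub_le {t s : ℝ} (ht : 0 ≤ t) (hs : 0 ≤ s) :
    |ouCovZero H t s ^ 2 - ouCov H (t - s) ^ 2| ≤ 5 * ouCov H 0 *
      (Real.exp (-t) * |ouCov H s| + Real.exp (-s) * |ouCov H t| +
        Real.exp (-t) * Real.exp (-s) * ouCov H 0) := by
  rw [sq_sub_sq, abs_mul]
  have h0 := ouCov_zero_nonneg H
  refine mul_le_mul ?_ (abs_ouCovZero_sub_le H t s) (abs_nonneg _) (by positivity)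
  have := abs_add_le (ouCovZero H t s) (ouCov H (t - s))
  linarith [abs_ouCovZero_le H ht hs, abs_ouCov_le H (t - s)]

/-- Each error term carries $e^{-t}$ or $e^{-s}$, whose integral is at most $1$, so the double
integral costs only one integral of $|r|$. That is $o(T)$ because $r$ vanishes at infinity. -/
theorem abs_integral_sq_ouCovZero_sub_le {T : ℝ} (hT : 0 ≤ T) :
    |∫ t in (0 : ℝ)..T, ∫ s in (0 : ℝ)..T, (ouCovZero H t s ^ 2 - ouCov H (t - s) ^ 2)| ≤
      5 * ouCov H 0 * (2 * (∫ t in (0 : ℝ)..T, |ouCov H t|) + ouCov H 0) := by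
  have hr := continuous_ouCov H
  have hρ := continuous_ouCovZero H
  have h0 := ouCov_zero_nonneg H
  set R := ∫ t in (0 : ℝ)..T, |ouCov H t| with hR
  set E := ∫ t in (0 : ℝ)..T, Real.exp (-t) with hE
  have hR0 : 0 ≤ R := intervalIntegral.integral_nonneg hT fun _ _ => abs_nonneg _
  have hE0 : 0 ≤ E := intervalIntegral.integral_nonneg hT fun _ _ => Real.exp_nonneg _
  have hE1 : E ≤ 1 := by
    rw [hE, intervalIntegral.integral_comp_neg (fun t => Real.exp t), integral_exp]
    simp [Real.exp_nonneg]
  have hin : ∀ t ∈ Set.Ioc 0 T,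
      ‖∫ s in (0 : ℝ)..T, (ouCovZero H t s ^ 2 - ouCov H (t - s) ^ 2)‖ ≤
      5 * ouCov H 0 * (Real.exp (-t) * R + E * |ouCov H t| + Real.exp (-t) * E * ouCov H 0) := by
    intro t ht
    have h1 := intervalIntegral.norm_integral_le_of_norm_le (μ := volume) hT
      (f := fun s => ouCovZero H t s ^ 2 - ouCov H (t - s) ^ 2)
      (ae_of_all _ fun s hs => abs_sq_ouCovZero_sub_le H ht.1.le (le_of_lt hs.1))
      (Continuous.intervalIntegrable (by fun_prop) _ _)
    refine h1.trans_eq ?_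
    rw [intervalIntegral.integral_const_mul, intervalIntegral.integral_add
        (Continuous.intervalIntegrable (by fun_prop) _ _)
        (Continuous.intervalIntegrable (by fun_prop) _ _),
      intervalIntegral.integral_add
        (Continuous.intervalIntegrable (by fun_prop) _ _)
        (Continuous.intervalIntegrable (by fun_prop) _ _),
      intervalIntegral.integral_const_mul, intervalIntegral.integral_mul_const,
      intervalIntegral.integral_mul_const, intervalIntegral.integral_const_mul]
  have hout := intervalIntegral.norm_integral_le_of_norm_le (μ := volume) hT
    (ae_of_all _ hin) (Continuous.intervalIntegrable (by fun_prop) _ _)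
  rw [Real.norm_eq_abs] at hout
  refine hout.trans ?_
  rw [intervalIntegral.integral_const_mul, intervalIntegral.integral_add
      (Continuous.intervalIntegrable (by fun_prop) _ _)
      (Continuous.intervalIntegrable (by fun_prop) _ _),
    intervalIntegral.integral_add
      (Continuous.intervalIntegrable (by fun_prop) _ _)
      (Continuous.intervalIntegrable (by fun_prop) _ _),
    intervalIntegral.integral_const_mul, intervalIntegral.integral_mul_const,
    intervalIntegral.integral_mul_const, intervalIntegral.integral_mul_const, ← hE, ← hR]
  refine mul_le_mul_of_nonneg_left ?_ (by positivity)
  have e1 : E * R ≤ 1 * R := by gcongr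
  have e2 : E * E * ouCov H 0 ≤ 1 * 1 * ouCov H 0 := by gcongr
  linarith

theorem tendsto_average_ouCovZero_sub :
    Tendsto (fun T : ℝ => 1 / T * (∫ t in (0 : ℝ)..T, ∫ s in (0 : ℝ)..T, ouCovZero H t s ^ 2) -
      1 / T * ∫ t in (0 : ℝ)..T, ∫ s in (0 : ℝ)..T, ouCov H (t - s) ^ 2) atTop (𝓝 0) := by
  have hr := continuous_ouCov H
  have hρ := continuous_ouCovZero H
  have h1 : Tendsto (fun T : ℝ => 5 * ouCov H 0 *
      (2 * (1 / T * ∫ t in (0 : ℝ)..T, |ouCov H t|) + ouCov H 0 * (1 / T))) atTop (𝓝 0) := by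
    have h2 := tendsto_average_zero (g := fun u => |ouCov H u|) (by fun_prop)
      (fun u => (abs_abs _).trans_le (abs_ouCov_le H u)) (by simpa using (tendsto_ouCov H).abs)
    have h3 : Tendsto (fun T : ℝ => 1 / T) atTop (𝓝 0) := by
      simpa using tendsto_inv_atTop_zero (𝕜 := ℝ)
    simpa using ((h2.const_mul 2).add (h3.const_mul (ouCov H 0))).const_mul (5 * ouCov H 0)
  refine squeeze_zero_norm' ?_ h1
  filter_upwards [eventually_gt_atTop 0] with T hT
  have h4 := abs_integral_sq_ouCovZero_sub_le H hT.le
  have h5 : ∀ t, ∫ s in (0 : ℝ)..T, (ouCovZero H t s ^ 2 - ouCov H (t - s) ^ 2) =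
      (∫ s in (0 : ℝ)..T, ouCovZero H t s ^ 2) - ∫ s in (0 : ℝ)..T, ouCov H (t - s) ^ 2 :=
    fun t => intervalIntegral.integral_sub (Continuous.intervalIntegrable (by fun_prop) _ _)
      (Continuous.intervalIntegrable (by fun_prop) _ _)
  simp_rw [h5] at h4
  rw [intervalIntegral.integral_sub] at h4
  · rw [← mul_sub, norm_mul, Real.norm_eq_abs, Real.norm_eq_abs, abs_of_pos (by positivity)]
    calc _ ≤ 1 / T * (5 * ouCov H 0 * (2 * (∫ t in (0 : ℝ)..T, |ouCov H t|) + ouCov H 0)) := by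
          gcongr
      _ = _ := by ring
  · refine Continuous.intervalIntegrable ?_ _ _
    exact intervalIntegral.continuous_parametric_intervalIntegral_of_continuous' (by fun_prop) _ _
  · refine Continuous.intervalIntegrable ?_ _ _
    exact intervalIntegral.continuous_parametric_intervalIntegral_of_continuous' (by fun_prop) _ _

/-- With $t=T\tau$ and $0<\tau<1$, all of $T-t$, $t$ and $T$ tend to infinity, so $\rho(T,t)\to0$.
-/
theorem tendsto_average_ouCovZero_boundary :
    Tendsto (fun T : ℝ => 1 / T * ∫ t in (0 : ℝ)..T, ouCovZero H T t ^ 2) atTop (𝓝 0) := by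
  have hρ := continuous_ouCovZero H
  have h0 := ouCov_zero_nonneg H
  have h : Tendsto (fun T : ℝ => ∫ τ in (0 : ℝ)..1, ouCovZero H T (T * τ) ^ 2) atTop
      (𝓝 (∫ _ in (0 : ℝ)..1, (0 : ℝ))) := by
    refine intervalIntegral.tendsto_integral_filter_of_dominated_convergence
      (fun _ => (4 * ouCov H 0) ^ 2) ?_ ?_ intervalIntegrable_const ?_
    · exact Eventually.of_forall fun T => Continuous.aestronglyMeasurable (by fun_prop)
    · filter_upwards [eventually_gt_atTop 0] with T hT
      refine ae_of_all _ fun τ hτ => ?_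
      rw [Set.uIoc_of_le zero_le_one] at hτ
      rw [Real.norm_of_nonneg (sq_nonneg _), sq_le_sq, abs_of_nonneg (by positivity :
        0 ≤ 4 * ouCov H 0)]
      exact abs_ouCovZero_le H hT.le (by have := hτ.1; positivity)
    · have h1 : ∀ᵐ τ : ℝ, τ ≠ 1 := compl_mem_ae_iff.2 (measure_singleton _)
      filter_upwards [h1] with τ hτ1 hτ
      rw [Set.uIoc_of_le zero_le_one] at hτ
      have h2 : 0 < 1 - τ := by linarith [lt_of_le_of_ne hτ.2 hτ1]
      have hr := tendsto_ouCov H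
      have a1 : Tendsto (fun T : ℝ => ouCov H (T - T * τ)) atTop (𝓝 0) := by
        refine (hr.comp (tendsto_id.atTop_mul_const h2)).congr fun T => ?_
        simp only [Function.comp_apply, id]
        ring_nf
      have a2 : Tendsto (fun T : ℝ => ouCov H (T * τ)) atTop (𝓝 0) :=
        hr.comp (tendsto_id.atTop_mul_const hτ.1)
      have a3 : Tendsto (fun T : ℝ => Real.exp (-T)) atTop (𝓝 0) :=
        Real.tendsto_exp_neg_atTop_nhds_zero
      have a4 : Tendsto (fun T : ℝ => Real.exp (-(T * τ))) atTop (𝓝 0) :=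
        a3.comp (tendsto_id.atTop_mul_const hτ.1)
      have a5 := (((a1.sub (a3.mul a2)).sub (a4.mul hr)).add
        ((a3.mul a4).mul_const (ouCov H 0))).pow 2
      simpa [ouCovZero] using a5
  simp only [intervalIntegral.integral_zero] at h
  refine h.congr' ?_
  filter_upwards [eventually_gt_atTop 0] with T hT
  rw [intervalIntegral.integral_comp_mul_left (fun t => ouCovZero H T t ^ 2) hT.ne', mul_zero,
    mul_one, smul_eq_mul, one_div]

/-- The squared norm of `f_T` in terms of the covariance of the Ornstein-Uhlenbeck process. -/
def ouNormSq (H T : ℝ) : ℝ :=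
  ouCovZero H T T ^ 2 + 4 * (∫ t in (0 : ℝ)..T, ouCovZero H T t ^ 2) +
    4 * ∫ t in (0 : ℝ)..T, ∫ s in (0 : ℝ)..T, ouCovZero H t s ^ 2

theorem tendsto_ouNormSq_sub :
    Tendsto (fun T : ℝ => 1 / (2 * T) * ouNormSq H T -
      2 * (1 / T * ∫ t in (0 : ℝ)..T, ∫ s in (0 : ℝ)..T, ouCov H (t - s) ^ 2)) atTop (𝓝 0) := by
  have h0 := ouCov_zero_nonneg H
  have h1 : Tendsto (fun T : ℝ => 1 / (2 * T) * ouCovZero H T T ^ 2) atTop (𝓝 0) := by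
    have h3 : Tendsto (fun T : ℝ => (4 * ouCov H 0) ^ 2 / 2 * (1 / T)) atTop (𝓝 0) := by
      simpa using (tendsto_inv_atTop_zero (𝕜 := ℝ)).const_mul ((4 * ouCov H 0) ^ 2 / 2)
    refine squeeze_zero_norm' ?_ h3
    filter_upwards [eventually_gt_atTop 0] with T hT
    rw [Real.norm_of_nonneg (by positivity)]
    have h4 : ouCovZero H T T ^ 2 ≤ (4 * ouCov H 0) ^ 2 := by
      rw [sq_le_sq, abs_of_nonneg (by positivity : 0 ≤ 4 * ouCov H 0)]
      exact abs_ouCovZero_le H hT.le hT.le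
    calc _ ≤ 1 / (2 * T) * (4 * ouCov H 0) ^ 2 := by gcongr
      _ = _ := by ring
  have h := (h1.add ((tendsto_average_ouCovZero_boundary H).const_mul 2)).add
    ((tendsto_average_ouCovZero_sub H).const_mul 2)
  simp only [mul_zero, add_zero] at h
  refine h.congr fun T => ?_
  rw [ouNormSq]
  ring

theorem tendsto_ouNormSq (hH : (H : ℝ) < 3 / 4) :
    Tendsto (fun T : ℝ => 1 / (2 * T) * ouNormSq H T) atTop (𝓝 (sigmaSq H)) := by
  have h := (tendsto_ouNormSq_sub H).add
    ((tendsto_average_comp_sub (integrable_ouCov_sq H hH) (fun u => sq_nonneg _)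
      ((continuous_ouCov H).pow 2)).const_mul 2)
  rw [two_mul_integral_ouCov_sq H hH, zero_add] at h
  refine h.congr fun T => ?_
  ring

/-- A finite limit would bound the averages of $r(t-s)^2$, hence the integrals of $r^2$ over
$[-T/3,T/3]$, and make $r^2$ integrable. -/
theorem not_tendsto_ouNormSq (hH : 3 / 4 ≤ (H : ℝ)) (l : ℝ) :
    ¬ Tendsto (fun T : ℝ => 1 / (2 * T) * ouNormSq H T) atTop (𝓝 l) := by
  intro h
  have h1 := h.sub (tendsto_ouNormSq_sub H)
  simp only [sub_sub_cancel, sub_zero] at h1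
  have hc : Continuous fun u => ouCov H u ^ 2 := (continuous_ouCov H).pow 2
  have ht : Tendsto (fun T : ℝ => T / 3) atTop atTop := tendsto_id.atTop_div_const (by norm_num)
  -- Twice the average is eventually at most $l+1$, and the integral over $[-T/3,T/3]$ is at most
  -- three times the average.
  refine not_integrable_ouCov_sq H hH (integrable_of_intervalIntegral_norm_bounded (l := atTop)
    (a := fun T : ℝ => -(T / 3)) (b := fun T : ℝ => T / 3) (3 / 2 * (l + 1))
    (fun T => (hc.integrableOn_Icc).mono_set Set.Ioc_subset_Icc_self)
    (tendsto_neg_atTop_atBot.comp ht) ht ?_)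
  filter_upwards [eventually_gt_atTop 0, h1.eventually_le_const (lt_add_one l)] with T hT hl
  have h2 := integral_le_average_comp_sub (fun u => sq_nonneg (ouCov H u)) hc hT
  simp_rw [Real.norm_of_nonneg (sq_nonneg _)]
  linarith

end

/-! ### Riemann sums -/

section

variable {E : Type*} [NormedAddCommGroup E] [NormedSpace ℝ E] [CompleteSpace E]

/-- The sum is the integral of $g$ evaluated at $t$ rounded down to the grid, so dominated
convergence applies. Continuity almost everywhere suffices, which matters for indicator functions;
vector values are needed for curves in the tensor square. -/
theorem tendsto_riemannSum {g : ℝ → E} {b M : ℝ} (hb : 0 < b)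
    (hM : ∀ t ∈ Set.Icc 0 b, ‖g t‖ ≤ M) (hg : ∀ᵐ t, t ∈ Set.Ioo 0 b → ContinuousAt g t) :
    Tendsto (fun n : ℕ => ∑ j ∈ Finset.range n, (b / n) • g (b * (j / n))) atTop
      (𝓝 (∫ t in (0 : ℝ)..b, g t)) := by
  have h : Tendsto (fun n : ℕ => ∫ t in (0 : ℝ)..b, g (b * (⌊t / b * n⌋₊ / n))) atTop
      (𝓝 (∫ t in (0 : ℝ)..b, g t)) := by
    refine intervalIntegral.tendsto_integral_filter_of_dominated_convergence (fun _ => M)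
      ?_ ?_ intervalIntegrable_const ?_
    · refine Eventually.of_forall fun n => StronglyMeasurable.aestronglyMeasurable ?_
      exact (StronglyMeasurable.of_discrete (f := fun k : ℕ => g (b * (k / n)))).comp_measurable
        (Nat.measurable_floor.comp (by fun_prop))
    · filter_upwards [eventually_gt_atTop 0] with n hn
      refine ae_of_all _ fun t ht => hM _ ?_
      rw [Set.uIoc_of_le hb.le] at ht
      have hn' : (0 : ℝ) < n := by exact_mod_cast hn
      have h1 : (⌊t / b * n⌋₊ : ℝ) ≤ t / b * n :=
        Nat.floor_le (by have := ht.1; positivity)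
      have h2 : t / b ≤ 1 := (div_le_one hb).2 ht.2
      refine ⟨by positivity, mul_le_of_le_one_right hb.le ?_⟩
      rw [div_le_one hn']
      nlinarith
    · have h1 : ∀ᵐ t : ℝ, t ≠ b := compl_mem_ae_iff.2 (measure_singleton _)
      filter_upwards [hg, h1] with t ht htb hmem
      rw [Set.uIoc_of_le hb.le] at hmem
      refine (ht ⟨hmem.1, lt_of_le_of_ne hmem.2 htb⟩).tendsto.comp ?_
      have h2 := ((tendsto_nat_floor_mul_div_atTop (R := ℝ) (a := t / b)
        (by have := hmem.1; positivity)).comp tendsto_natCast_atTop_atTop).const_mul b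
      rw [mul_div_cancel₀ _ hb.ne'] at h2
      exact h2
  refine h.congr' ?_
  filter_upwards [eventually_gt_atTop 0] with n hn
  have hn' : (0 : ℝ) < n := by exact_mod_cast hn
  have hc : ∀ j : ℕ, Set.EqOn (fun t => g (b * (⌊t / b * n⌋₊ / n))) (fun _ => g (b * (j / n)))
      (Set.Ioo (b * (j / n)) (b * ((j + 1 : ℕ) / n))) := by
    intro j t ht
    have h1 : (j : ℝ) < t / b * n := by
      have := ht.1
      rw [div_mul_eq_mul_div, lt_div_iff₀ hb]
      rw [mul_div_assoc', div_lt_iff₀ hn'] at this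
      linarith
    have h2 : t / b * n < j + 1 := by
      have := ht.2
      rw [div_mul_eq_mul_div, div_lt_iff₀ hb]
      rw [mul_div_assoc', lt_div_iff₀ hn'] at this
      push_cast at this
      linarith
    have h3 : ⌊t / b * n⌋₊ = j := (Nat.floor_eq_iff ((Nat.cast_nonneg j).trans h1.le)).2 ⟨h1.le, h2⟩
    simp only [h3]
  have hle : ∀ j : ℕ, b * ((j : ℝ) / n) ≤ b * (((j + 1 : ℕ) : ℝ) / n) := fun j => by
    push_cast
    gcongr
    linarith
  have hsum := intervalIntegral.sum_integral_adjacent_intervals (μ := volume)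
    (f := fun t => g (b * (⌊t / b * n⌋₊ / n))) (a := fun j : ℕ => b * ((j : ℝ) / n)) (n := n)
    (fun j _ => by
      refine (intervalIntegrable_const (c := g (b * (j / n)))).congr_uIoo ?_
      rw [Set.uIoo_of_le (hle j)]
      exact (hc j).symm)
  simp only [Nat.cast_zero, zero_div, mul_zero, div_self hn'.ne', mul_one] at hsum
  rw [← hsum]
  refine Finset.sum_congr rfl fun j _ => ?_
  rw [intervalIntegral.integral_congr_Ioo_of_le (hle j) (hc j), intervalIntegral.integral_const]
  congr 1
  push_cast
  field_simp
  ring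

end

/-! ### Operations on functions in the tensor square -/

namespace IsFbmTensor

variable {H : HurstParameter} {T : ℝ} {x y : FbmTensorSq H T} {f g : ℝ × ℝ → ℝ}

theorem of_forall_pos (h : ∀ ε : ℝ, 0 < ε → ∃ φ : FbmStep₂ T,
    eLpNorm (fun z => φ.toFun z - f z) 2
      (volume.restrict (Set.Icc (0 : ℝ) T ×ˢ Set.Icc (0 : ℝ) T)) ≤ ENNReal.ofReal ε ∧
    ‖φ.toTensor H - x‖ ≤ ε) : IsFbmTensor x f := by
  choose φ hφ hφx using fun n : ℕ => h (1 / ((n : ℝ) + 1)) (by positivity)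
  have h0 := tendsto_one_div_add_atTop_nhds_zero_nat (𝕜 := ℝ)
  refine ⟨φ, ?_, ?_⟩
  · have h1 := ENNReal.tendsto_ofReal h0
    rw [ENNReal.ofReal_zero] at h1
    exact tendsto_of_tendsto_of_tendsto_of_le_of_le tendsto_const_nhds h1 (fun _ => zero_le) hφ
  · rw [tendsto_iff_norm_sub_tendsto_zero]
    exact squeeze_zero (fun _ => norm_nonneg _) hφx h0

theorem exists_step (h : IsFbmTensor x f) {ε : ℝ} (hε : 0 < ε) : ∃ φ : FbmStep₂ T,
    eLpNorm (fun z => φ.toFun z - f z) 2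
      (volume.restrict (Set.Icc (0 : ℝ) T ×ˢ Set.Icc (0 : ℝ) T)) ≤ ENNReal.ofReal ε ∧
    ‖φ.toTensor H - x‖ ≤ ε := by
  obtain ⟨φ, hφ, hx⟩ := h
  rw [tendsto_iff_norm_sub_tendsto_zero] at hx
  obtain ⟨n, h1, h2⟩ := ((hφ.eventually_le_const (ENNReal.ofReal_pos.2 hε)).and
    (hx.eventually_le_const hε)).exists
  exact ⟨φ n, h1, h2⟩

theorem add (hf : Measurable f) (hg : Measurable g) (hx : IsFbmTensor x f)
    (hy : IsFbmTensor y g) : IsFbmTensor (x + y) (fun z => f z + g z) := by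
  obtain ⟨φ, hφ, hφx⟩ := hx
  obtain ⟨ψ, hψ, hψy⟩ := hy
  refine ⟨fun n => φ n + ψ n, ?_, ?_⟩
  · have h := hφ.add hψ
    rw [add_zero] at h
    refine tendsto_of_tendsto_of_tendsto_of_le_of_le tendsto_const_nhds h (fun _ => zero_le)
      fun n => ?_
    have h1 : (fun z => (φ n + ψ n).toFun z - (f z + g z)) =
        (fun z => (φ n).toFun z - f z) + fun z => (ψ n).toFun z - g z := by
      ext z
      simp only [FbmStep₂.toFun_add, Pi.add_apply]
      ring
    dsimp only
    rw [h1]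
    exact eLpNorm_add_le ((FbmStep₂.measurable_toFun _).sub hf).aestronglyMeasurable
      ((FbmStep₂.measurable_toFun _).sub hg).aestronglyMeasurable (by norm_num)
  · simp_rw [FbmStep₂.toTensor_add]
    exact hφx.add hψy

theorem const_smul (c : ℝ) (hx : IsFbmTensor x f) : IsFbmTensor (c • x) (fun z => c * f z) := by
  obtain ⟨φ, hφ, hφx⟩ := hx
  refine ⟨fun n => c • φ n, ?_, ?_⟩
  · have h : Tendsto (fun n => ‖c‖ₑ * eLpNorm (fun z => (φ n).toFun z - f z) 2
        (volume.restrict (Set.Icc (0 : ℝ) T ×ˢ Set.Icc (0 : ℝ) T))) atTop (𝓝 0) := by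
      simpa using ENNReal.Tendsto.const_mul (a := ‖c‖ₑ) hφ (Or.inr enorm_ne_top)
    refine h.congr fun n => ?_
    rw [← eLpNorm_const_smul]
    congr 1
    ext z
    simp only [FbmStep₂.toFun_smul, Pi.smul_apply, smul_eq_mul]
    ring
  · simp_rw [FbmStep₂.toTensor_smul]
    exact hφx.const_smul c

theorem zero : IsFbmTensor (0 : FbmTensorSq H T) (fun _ => 0) :=
  ⟨fun _ => 0, by simp [FbmStep₂.toFun], by simp [FbmStep₂.toTensor]⟩

theorem sum {ι : Type*} (s : Finset ι) {x : ι → FbmTensorSq H T} {f : ι → ℝ × ℝ → ℝ}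
    (hf : ∀ i ∈ s, Measurable (f i)) (hx : ∀ i ∈ s, IsFbmTensor (x i) (f i)) :
    IsFbmTensor (∑ i ∈ s, x i) (fun z => ∑ i ∈ s, f i z) := by
  classical
  induction s using Finset.induction_on with
  | empty => simpa using zero
  | insert a s ha ih =>
    simp_rw [Finset.sum_insert ha]
    exact add (hf a (Finset.mem_insert_self _ _))
      (Finset.measurable_sum _ fun i hi => hf i (Finset.mem_insert_of_mem hi))
      (hx a (Finset.mem_insert_self _ _))
      (ih (fun i hi => hf i (Finset.mem_insert_of_mem hi))
        fun i hi => hx i (Finset.mem_insert_of_mem hi))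

/-- Uniformly bounded pointwise convergence on a set of finite measure is $L^2$ convergence; then
approximate one late term by a step function within $\varepsilon/2$ in both norms. -/
theorem of_tendsto {x : ℕ → FbmTensorSq H T} {f : ℕ → ℝ × ℝ → ℝ} {x' : FbmTensorSq H T}
    {f' : ℝ × ℝ → ℝ} {M : ℝ} (hf : ∀ n, Measurable (f n)) (hM : ∀ n z, |f n z| ≤ M)
    (hx : ∀ n, IsFbmTensor (x n) (f n)) (hlim : Tendsto x atTop (𝓝 x'))
    (hflim : ∀ z, Tendsto (fun n => f n z) atTop (𝓝 (f' z))) : IsFbmTensor x' f' := by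
  set μ := volume.restrict (Set.Icc (0 : ℝ) T ×ˢ Set.Icc (0 : ℝ) T) with hμ
  have : IsFiniteMeasure μ := ⟨by
    rw [hμ, Measure.restrict_apply_univ]
    exact (isCompact_Icc.prod isCompact_Icc).measure_lt_top⟩
  have hf' : Measurable f' := measurable_of_tendsto_metrizable hf (tendsto_pi_nhds.2 hflim)
  have hM' : ∀ z, |f' z| ≤ M := fun z => le_of_tendsto' (hflim z).abs fun n => hM n z
  have hM0 : 0 ≤ M := (abs_nonneg _).trans (hM 0 0)
  have hL2 : Tendsto (fun n => eLpNorm (fun z => f n z - f' z) 2 μ) atTop (𝓝 0) := by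
    have h1 : Tendsto (fun n => ∫⁻ z, ‖f n z - f' z‖ₑ ^ (2 : ℝ) ∂μ) atTop
        (𝓝 (∫⁻ _, 0 ∂μ)) := by
      refine tendsto_lintegral_of_dominated_convergence
        (fun _ => ENNReal.ofReal (2 * M) ^ (2 : ℝ)) (fun n => ?_) (fun n => ae_of_all _ fun z => ?_)
        ?_ (ae_of_all _ fun z => ?_)
      · exact (((hf n).sub hf').enorm).pow_const _
      · refine ENNReal.rpow_le_rpow ?_ (by norm_num)
        rw [← ofReal_norm]
        refine ENNReal.ofReal_le_ofReal ?_
        refine (norm_sub_le _ _).trans ?_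
        have := hM n z
        have := hM' z
        simp only [Real.norm_eq_abs]
        linarith
      · rw [lintegral_const]
        exact ENNReal.mul_ne_top (ENNReal.rpow_ne_top_of_nonneg (by norm_num)
          ENNReal.ofReal_ne_top) (measure_ne_top _ _)
      · have h2 : Tendsto (fun n => ‖f n z - f' z‖ₑ) atTop (𝓝 0) := by
          rw [← tendsto_zero_iff_enorm_tendsto_zero]
          simpa using (hflim z).sub_const (f' z)
        have h3 := (ENNReal.continuous_rpow_const (y := 2)).continuousAt.tendsto.comp h2
        rwa [ENNReal.zero_rpow_of_pos (by norm_num)] at h3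
    rw [lintegral_zero] at h1
    have h3 := (ENNReal.continuous_rpow_const (y := 1 / 2)).continuousAt.tendsto.comp h1
    rw [ENNReal.zero_rpow_of_pos (by norm_num)] at h3
    refine h3.congr fun n => ?_
    rw [eLpNorm_eq_lintegral_rpow_enorm_toReal two_ne_zero ENNReal.ofNat_ne_top]
    simp
  rw [tendsto_iff_norm_sub_tendsto_zero] at hlim
  refine of_forall_pos fun ε hε => ?_
  have hε2 : 0 < ε / 2 := by positivity
  obtain ⟨n, h1, h2⟩ := ((hL2.eventually_le_const (ENNReal.ofReal_pos.2 hε2)).and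
    (hlim.eventually_le_const hε2)).exists
  obtain ⟨φ, hφ, hφx⟩ := (hx n).exists_step hε2
  refine ⟨φ, ?_, ?_⟩
  · have h3 : (fun z => φ.toFun z - f' z) =
        (fun z => φ.toFun z - f n z) + fun z => f n z - f' z := by
      ext z
      simp
    rw [h3, ← add_halves ε, ENNReal.ofReal_add hε2.le hε2.le]
    exact (eLpNorm_add_le ((FbmStep₂.measurable_toFun _).sub (hf n)).aestronglyMeasurable
      ((hf n).sub hf').aestronglyMeasurable (by norm_num)).trans (add_le_add hφ h1)
  · have h3 : φ.toTensor H - x' = (φ.toTensor H - x n) + (x n - x') := by abel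
    rw [h3]
    exact (norm_add_le _ _).trans (by linarith)

/-- The same Riemann sums converge to the vector integral in the tensor square and to the scalar
integral at each point. Only almost everywhere continuity is asked of $t\mapsto f_t(z)$, as
$1_{[0,t]}(s)$ jumps at $t=s$. -/
theorem intervalIntegral {b M : ℝ} (hb : 0 ≤ b) {x : ℝ → FbmTensorSq H T} {f : ℝ → ℝ × ℝ → ℝ}
    (hxc : ContinuousOn x (Set.Icc 0 b)) (hf : ∀ t ∈ Set.Icc 0 b, Measurable (f t))
    (hM : ∀ t ∈ Set.Icc 0 b, ∀ z, |f t z| ≤ M)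
    (hfc : ∀ z, ∀ᵐ t, t ∈ Set.Ioo 0 b → ContinuousAt (fun t => f t z) t)
    (hx : ∀ t ∈ Set.Icc 0 b, IsFbmTensor (x t) (f t)) :
    IsFbmTensor (∫ t in (0 : ℝ)..b, x t) (fun z => ∫ t in (0 : ℝ)..b, f t z) := by
  rcases hb.eq_or_lt with rfl | hb
  · simpa using zero
  have hM0 : 0 ≤ M := (abs_nonneg _).trans (hM 0 ⟨le_rfl, hb.le⟩ 0)
  obtain ⟨K, hK⟩ := isCompact_Icc.exists_bound_of_continuousOn hxc
  have hmem : ∀ n : ℕ, ∀ j ∈ Finset.range n, b * ((j : ℝ) / n) ∈ Set.Icc 0 b := fun n j hj => by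
    have h1 : (j : ℝ) < n := by exact_mod_cast Finset.mem_range.1 hj
    have h2 : (0 : ℝ) < n := (Nat.cast_nonneg j).trans_lt h1
    exact ⟨by positivity, mul_le_of_le_one_right hb.le ((div_le_one h2).2 h1.le)⟩
  refine of_tendsto (M := b * M)
    (x := fun n : ℕ => ∑ j ∈ Finset.range n, (b / n) • x (b * (j / n)))
    (f := fun n z => ∑ j ∈ Finset.range n, (b / n) * f (b * (j / n)) z) ?_ ?_ ?_ ?_ ?_
  · exact fun n => Finset.measurable_sum _ fun j hj => (hf _ (hmem n j hj)).const_mul _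
  · intro n z
    refine (Finset.abs_sum_le_sum_abs _ _).trans ?_
    calc _ ≤ ∑ j ∈ Finset.range n, b / n * M := Finset.sum_le_sum fun j hj => by
          rw [abs_mul, abs_of_nonneg (by positivity)]
          have := hM _ (hmem n j hj) z
          gcongr
      _ = n * (b / n * M) := by simp
      _ ≤ b * M := by
          rcases eq_or_ne (n : ℝ) 0 with h | h
          · rw [h]
            simp only [zero_mul]
            positivity
          · exact le_of_eq (by field_simp)
  · exact fun n => sum _ (fun j hj => (hf _ (hmem n j hj)).const_mul _)
      fun j hj => (hx _ (hmem n j hj)).const_smul _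
  · exact tendsto_riemannSum hb hK (ae_of_all _ fun t ht =>
      (hxc t (Set.Ioo_subset_Icc_self ht)).continuousAt (Icc_mem_nhds ht.1 ht.2))
  · intro z
    simpa using tendsto_riemannSum (g := fun t => f t z) hb (fun t ht => hM t ht z) (hfc z)

end IsFbmTensor

/-! ### The Ornstein-Uhlenbeck elements -/

/-- Expand $\|F(x)-F(a)\|^2$ into inner products. Continuity of the covariance thus yields norm
continuity of the curve. -/
theorem continuous_of_continuous_inner {X E : Type*} [TopologicalSpace X] [NormedAddCommGroup E]
    [InnerProductSpace ℝ E] {F : X → E}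
    (h : Continuous fun p : X × X => inner ℝ (F p.1) (F p.2)) : Continuous F := by
  rw [continuous_iff_continuousAt]
  intro a
  rw [ContinuousAt, tendsto_iff_norm_sub_tendsto_zero]
  have h1 : Continuous fun x => inner ℝ (F x) (F x) - 2 * inner ℝ (F x) (F a) +
      inner ℝ (F a) (F a) :=
    ((h.comp (continuous_id.prodMk continuous_id)).sub
      ((h.comp (continuous_id.prodMk continuous_const)).const_mul 2)).add continuous_const
  have h2 : ∀ x, ‖F x - F a‖ = √(inner ℝ (F x) (F x) - 2 * inner ℝ (F x) (F a) +
      inner ℝ (F a) (F a)) := fun x => by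
    rw [real_inner_self_eq_norm_sq, real_inner_self_eq_norm_sq, ← norm_sub_sq_real,
      Real.sqrt_sq (norm_nonneg _)]
  simp_rw [h2]
  have h3 := (h1.sqrt).tendsto a
  rwa [show inner ℝ (F a) (F a) - 2 * inner ℝ (F a) (F a) + inner ℝ (F a) (F a) = (0 : ℝ) by ring,
    Real.sqrt_zero] at h3

theorem continuous_fbmCov (H : HurstParameter) :
    Continuous fun p : ℝ × ℝ => fbmCov H p.1 p.2 := by
  have h : 0 ≤ 2 * (H : ℝ) := (two_mul_hurst_mem H).1.le
  unfold fbmCov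
  exact continuous_const.mul (((continuous_fst.rpow_const fun _ => Or.inr h).add
    (continuous_snd.rpow_const fun _ => Or.inr h)).sub
    ((continuous_fst.sub continuous_snd).abs.rpow_const fun _ => Or.inr h))

/-- The element `1_{[0,t]}` of the Hilbert space, with `t` projected to `[0, T]`. -/
def fbmInd (H : HurstParameter) {T : ℝ} (hT : 0 ≤ T) (t : ℝ) : FbmHilbert H T :=
  (FbmStep.ind H (Set.projIcc 0 T hT t) : FbmStep H T)

/-- The element of the Hilbert space given by `s ↦ e^{-(t - s)} 1_{[0,t]}(s)`. -/
def ouElt (H : HurstParameter) {T : ℝ} (hT : 0 ≤ T) (t : ℝ) : FbmHilbert H T :=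
  fbmInd H hT t - ∫ v in (0 : ℝ)..t, Real.exp (-(t - v)) • fbmInd H hT v

section

variable (H : HurstParameter) {T : ℝ} (hT : 0 ≤ T)

theorem inner_fbmInd {s t : ℝ} (hs : s ∈ Set.Icc 0 T) (ht : t ∈ Set.Icc 0 T) :
    inner ℝ (fbmInd H hT s) (fbmInd H hT t) = fbmCov H s t := by
  rw [fbmInd, fbmInd, UniformSpace.Completion.inner_coe, FbmStep.inner_ind,
    Set.projIcc_of_mem hT hs, Set.projIcc_of_mem hT ht]

theorem continuous_fbmInd : Continuous (fbmInd H hT) := by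
  refine continuous_of_continuous_inner ?_
  have h : ∀ p : ℝ × ℝ, inner ℝ (fbmInd H hT p.1) (fbmInd H hT p.2) =
      fbmCov H (Set.projIcc 0 T hT p.1) (Set.projIcc 0 T hT p.2) := fun p => by
    rw [fbmInd, fbmInd, UniformSpace.Completion.inner_coe, FbmStep.inner_ind]
  simp_rw [h]
  have hc : Continuous fun t : ℝ => (Set.projIcc 0 T hT t : ℝ) :=
    continuous_subtype_val.comp continuous_projIcc
  exact (continuous_fbmCov H).comp ((hc.comp continuous_fst).prodMk (hc.comp continuous_snd))

theorem inner_ouElt_right (y : FbmHilbert H T) (t : ℝ) :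
    inner ℝ y (ouElt H hT t) = inner ℝ y (fbmInd H hT t) -
      ∫ v in (0 : ℝ)..t, Real.exp (-(t - v)) * inner ℝ y (fbmInd H hT v) := by
  have hc := continuous_fbmInd H hT
  have h := (innerSL ℝ y).intervalIntegral_comp_comm (μ := volume) (a := 0) (b := t)
    (f := fun v => Real.exp (-(t - v)) • fbmInd H hT v)
    (Continuous.intervalIntegrable (by fun_prop) _ _)
  simp only [innerSL_apply_apply, inner_smul_right] at h
  rw [ouElt, inner_sub_right, ← h]

theorem inner_ouElt_fbmInd {t w : ℝ} (ht : t ∈ Set.Icc 0 T) (hw : w ∈ Set.Icc 0 T) :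
    inner ℝ (ouElt H hT t) (fbmInd H hT w) =
      fbmCov H t w - ∫ v in (0 : ℝ)..t, Real.exp (-(t - v)) * fbmCov H v w := by
  rw [real_inner_comm, inner_ouElt_right, real_inner_comm, inner_fbmInd H hT ht hw]
  congr 1
  refine intervalIntegral.integral_congr fun v hv => ?_
  rw [Set.uIcc_of_le ht.1] at hv
  rw [real_inner_comm, inner_fbmInd H hT ⟨hv.1, hv.2.trans ht.2⟩ hw]

theorem inner_ouElt {t s : ℝ} (ht : t ∈ Set.Icc 0 T) (hs : s ∈ Set.Icc 0 T) :
    inner ℝ (ouElt H hT t) (ouElt H hT s) = ouCovZero H t s := by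
  rw [inner_ouElt_right, inner_ouElt_fbmInd H hT ht hs,
    ← fbmCov_sub_integral_sub_integral H ht.1 hs.1]
  congr 1
  refine intervalIntegral.integral_congr fun w hw => ?_
  rw [Set.uIcc_of_le hs.1] at hw
  rw [inner_ouElt_fbmInd H hT ht ⟨hw.1, hw.2.trans hs.2⟩]

theorem continuousOn_ouElt : ContinuousOn (ouElt H hT) (Set.Icc 0 T) := by
  have hc : Continuous fun p : Set.Icc (0 : ℝ) T × Set.Icc (0 : ℝ) T =>
      ouCovZero H p.1 p.2 :=
    Continuous.comp (g := fun z : ℝ × ℝ => ouCovZero H z.1 z.2)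
      (f := fun p : Set.Icc (0 : ℝ) T × Set.Icc (0 : ℝ) T => ((p.1 : ℝ), (p.2 : ℝ)))
      (continuous_ouCovZero H) (by fun_prop)
  refine continuousOn_iff_continuous_domRestrict.2 (continuous_of_continuous_inner
    (F := fun p : Set.Icc (0 : ℝ) T => ouElt H hT p) ?_)
  exact hc.congr fun p => (inner_ouElt H hT p.1.2 p.2.2).symm

/-- The tensor product as a continuous bilinear map into the Hilbert space tensor square. -/
def fbmTmul (H : HurstParameter) (T : ℝ) :
    FbmHilbert H T →L[ℝ] FbmHilbert H T →L[ℝ] FbmTensorSq H T :=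
  (ContinuousLinearMap.compL ℝ _ _ _ UniformSpace.Completion.toComplL).comp
    (TensorProduct.mkL ℝ (FbmHilbert H T) (FbmHilbert H T))

theorem fbmTmul_apply (x y : FbmHilbert H T) :
    fbmTmul H T x y = ((x ⊗ₜ[ℝ] y : FbmHilbert H T ⊗[ℝ] FbmHilbert H T) : FbmTensorSq H T) :=
  rfl

theorem inner_fbmTmul (x y x' y' : FbmHilbert H T) :
    inner ℝ (fbmTmul H T x y) (fbmTmul H T x' y') = inner ℝ x x' * inner ℝ y y' := by
  rw [fbmTmul_apply, fbmTmul_apply, UniformSpace.Completion.inner_coe, TensorProduct.inner_tmul]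

/-! ### Identifying the Ornstein-Uhlenbeck elements with functions -/

/-- The function `s ↦ e^{-(t - s)} 1_{[0,t]}(s)`. -/
def ouFun (t s : ℝ) : ℝ := (Set.Icc 0 t).indicator (fun s => Real.exp (-(t - s))) s

theorem measurable_ouFun (t : ℝ) : Measurable (ouFun t) :=
  Measurable.indicator (by fun_prop) measurableSet_Icc

theorem ouFun_nonneg (t s : ℝ) : 0 ≤ ouFun t s :=
  Set.indicator_nonneg (fun _ _ => Real.exp_nonneg _) _

theorem abs_ouFun_le (t s : ℝ) : |ouFun t s| ≤ 1 := by
  rw [abs_of_nonneg (ouFun_nonneg t s), ouFun]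
  by_cases h : s ∈ Set.Icc 0 t
  · rw [Set.indicator_of_mem h]
    exact Real.exp_le_one_iff.2 (by linarith [h.2])
  · rw [Set.indicator_of_notMem h]
    exact zero_le_one

/-- Whether $s$ lies in $[0,u]$ is locally constant in $u$ away from $u=s$; the constant is $0$ or
$1$. -/
theorem indicator_Icc_eventuallyEq {t s : ℝ} (h : t ≠ s) (k : ℝ → ℝ → ℝ) :
    ∃ c : ℝ, ∀ᶠ u in 𝓝 t, (Set.Icc 0 u).indicator (k u) s = c * k u s := by
  by_cases h0 : 0 ≤ s
  · rcases lt_or_gt_of_ne h with h | h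
    · refine ⟨0, ?_⟩
      filter_upwards [eventually_lt_nhds h] with u hu
      rw [Set.indicator_of_notMem (fun h' => hu.not_ge h'.2), zero_mul]
    · refine ⟨1, ?_⟩
      filter_upwards [eventually_gt_nhds h] with u hu
      rw [Set.indicator_of_mem (show s ∈ Set.Icc 0 u from ⟨h0, hu.le⟩), one_mul]
  · exact ⟨0, Eventually.of_forall fun u => by
      rw [Set.indicator_of_notMem (fun h' => h0 h'.1), zero_mul]⟩

theorem continuousAt_indicator_Icc {t s : ℝ} (h : t ≠ s) {k : ℝ → ℝ → ℝ}
    (hk : Continuous fun u => k u s) :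
    ContinuousAt (fun u => (Set.Icc 0 u).indicator (k u) s) t := by
  obtain ⟨c, hc⟩ := indicator_Icc_eventuallyEq h k
  exact (hk.const_mul c).continuousAt.congr (hc.mono fun _ h => h.symm)

theorem integral_mul_indicator_Icc {k : ℝ → ℝ} (hk : Continuous k) {t s : ℝ} (hs : 0 ≤ s)
    (hst : s ≤ t) :
    ∫ v in (0 : ℝ)..t, k v * (Set.Icc 0 v).indicator 1 s = ∫ v in s..t, k v := by
  have h1 : Set.EqOn (fun v => k v * (Set.Icc 0 v).indicator 1 s) (fun _ => (0 : ℝ))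
      (Set.Ioo 0 s) := fun v hv => by
    simp only
    rw [Set.indicator_of_notMem (fun h' => hv.2.not_ge h'.2), mul_zero]
  have h2 : Set.EqOn (fun v => k v * (Set.Icc 0 v).indicator 1 s) k (Set.Ioo s t) :=
      fun v hv => by
    simp only
    rw [Set.indicator_of_mem (show s ∈ Set.Icc 0 v from ⟨hs, hv.1.le⟩), Pi.one_apply, mul_one]
  have i1 : IntervalIntegrable (fun v => k v * (Set.Icc 0 v).indicator 1 s) volume 0 s := by
    refine (intervalIntegrable_const (c := (0 : ℝ))).congr_uIoo ?_
    rw [Set.uIoo_of_le hs]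
    exact h1.symm
  have i2 : IntervalIntegrable (fun v => k v * (Set.Icc 0 v).indicator 1 s) volume s t := by
    refine (hk.intervalIntegrable s t).congr_uIoo ?_
    rw [Set.uIoo_of_le hst]
    exact h2.symm
  rw [← intervalIntegral.integral_add_adjacent_intervals i1 i2,
    intervalIntegral.integral_congr_Ioo_of_le hs h1,
    intervalIntegral.integral_congr_Ioo_of_le hst h2, intervalIntegral.integral_zero, zero_add]

/-- Pointwise counterpart of the definition of `ouElt`: for $0\le s\le t$ it says
$e^{-(t-s)}=1-\int_s^t e^{-(t-v)}\,dv$. -/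
theorem ouFun_eq {t : ℝ} (ht : 0 ≤ t) (s : ℝ) :
    ouFun t s = (Set.Icc 0 t).indicator 1 s -
      ∫ v in (0 : ℝ)..t, Real.exp (-(t - v)) * (Set.Icc 0 v).indicator 1 s := by
  by_cases h : s ∈ Set.Icc 0 t
  · rw [ouFun, Set.indicator_of_mem h, Set.indicator_of_mem h,
      integral_mul_indicator_Icc (by fun_prop) h.1 h.2]
    have h1 : ∀ v ∈ Set.uIcc s t,
        HasDerivAt (fun v => Real.exp (-(t - v))) (Real.exp (-(t - v))) v := fun v _ => by
      simpa using (((hasDerivAt_id v).const_sub t).neg).exp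
    rw [intervalIntegral.integral_eq_sub_of_hasDerivAt h1
      (Continuous.intervalIntegrable (by fun_prop) _ _)]
    simp
  · have h1 : Set.EqOn (fun v => Real.exp (-(t - v)) * (Set.Icc 0 v).indicator 1 s)
        (fun _ => (0 : ℝ)) (Set.uIcc 0 t) := fun v hv => by
      rw [Set.uIcc_of_le ht] at hv
      simp only
      rw [Set.indicator_of_notMem (fun h' => h ⟨h'.1, h'.2.trans hv.2⟩), mul_zero]
    rw [ouFun, Set.indicator_of_notMem h, Set.indicator_of_notMem h,
      intervalIntegral.integral_congr h1]
    simp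

theorem measurable_indicator_Icc (t : ℝ) : Measurable ((Set.Icc 0 t).indicator (1 : ℝ → ℝ)) :=
  measurable_one.indicator measurableSet_Icc

theorem abs_indicator_Icc_le (t s : ℝ) : |(Set.Icc 0 t).indicator (1 : ℝ → ℝ) s| ≤ 1 := by
  by_cases h : s ∈ Set.Icc 0 t
  · simp [Set.indicator_of_mem h]
  · simp [Set.indicator_of_notMem h]

theorem FbmStep₂.toTensor_single (p : Set.Icc (0 : ℝ) T × Set.Icc (0 : ℝ) T) :
    FbmStep₂.toTensor H (Finsupp.single p 1 : FbmStep₂ T) =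
      ((((FbmStep.ind H p.1 : FbmStep H T) : FbmHilbert H T) ⊗ₜ[ℝ]
        ((FbmStep.ind H p.2 : FbmStep H T) : FbmHilbert H T) :
          FbmHilbert H T ⊗[ℝ] FbmHilbert H T) : FbmTensorSq H T) := by
  unfold FbmStep₂.toTensor
  rw [Finsupp.sum_single_index, one_smul]
  exact zero_smul ℝ _

theorem isFbmTensor_fbmInd {v w : ℝ} (hv : v ∈ Set.Icc 0 T) (hw : w ∈ Set.Icc 0 T) :
    IsFbmTensor (fbmTmul H T (fbmInd H hT v) (fbmInd H hT w))
      (fun z => (Set.Icc 0 v).indicator 1 z.1 * (Set.Icc 0 w).indicator 1 z.2) := by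
  refine ⟨fun _ => (Finsupp.single (⟨v, hv⟩, ⟨w, hw⟩) 1 : FbmStep₂ T), ?_, ?_⟩
  · have h : ∀ z : ℝ × ℝ,
        FbmStep₂.toFun (T := T) (Finsupp.single (⟨v, hv⟩, ⟨w, hw⟩) 1) z -
          (Set.Icc 0 v).indicator 1 z.1 * (Set.Icc 0 w).indicator 1 z.2 = 0 := fun z => by
      unfold FbmStep₂.toFun
      rw [Finsupp.sum_single_index (by simp), one_mul, sub_eq_zero]
      exact Set.indicator_prod_one
    simp_rw [h]
    simp
  · rw [fbmTmul_apply, fbmInd, fbmInd, Set.projIcc_of_mem hT hv, Set.projIcc_of_mem hT hw]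
    simp_rw [FbmStep₂.toTensor_single]
    exact tendsto_const_nhds

/-- The tensor factors are replaced one at a time, so that only integrals over one parameter occur.
-/
theorem isFbmTensor_ouElt_fbmInd {t w : ℝ} (ht : t ∈ Set.Icc 0 T) (hw : w ∈ Set.Icc 0 T) :
    IsFbmTensor (fbmTmul H T (ouElt H hT t) (fbmInd H hT w))
      (fun z => ouFun t z.1 * (Set.Icc 0 w).indicator 1 z.2) := by
  have hc := continuous_fbmInd H hT
  have hm : ∀ v : ℝ, Measurable fun z : ℝ × ℝ =>
      (Set.Icc 0 v).indicator (1 : ℝ → ℝ) z.1 * (Set.Icc 0 w).indicator 1 z.2 := fun v =>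
    ((measurable_indicator_Icc v).comp measurable_fst).mul
      ((measurable_indicator_Icc w).comp measurable_snd)
  have h1 := IsFbmTensor.intervalIntegral (H := H) (T := T) (M := 1) ht.1
    (x := fun v => Real.exp (-(t - v)) • fbmTmul H T (fbmInd H hT v) (fbmInd H hT w))
    (f := fun v z => Real.exp (-(t - v)) *
      ((Set.Icc 0 v).indicator 1 z.1 * (Set.Icc 0 w).indicator 1 z.2))
    (Continuous.continuousOn (by fun_prop)) (fun v _ => (hm v).const_mul _)
    (fun v hv z => by
      rw [abs_mul, abs_mul, Real.abs_exp]
      have e1 : Real.exp (-(t - v)) ≤ 1 := Real.exp_le_one_iff.2 (by linarith [hv.2])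
      exact mul_le_one₀ e1 (by positivity) (mul_le_one₀ (abs_indicator_Icc_le _ _)
        (abs_nonneg _) (abs_indicator_Icc_le _ _)))
    (fun z => by
      have h : ∀ᵐ v : ℝ, v ≠ z.1 := compl_mem_ae_iff.2 (measure_singleton _)
      filter_upwards [h] with v hv _
      exact ContinuousAt.mul (Continuous.continuousAt (by fun_prop))
        ((continuousAt_indicator_Icc (k := fun _ => 1) hv continuous_const).mul
          continuousAt_const))
    (fun v hv => (isFbmTensor_fbmInd H hT ⟨hv.1, hv.2.trans ht.2⟩ hw).const_smul _)
  have hmi : Measurable fun z : ℝ × ℝ => ∫ v in (0 : ℝ)..t, Real.exp (-(t - v)) *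
      ((Set.Icc 0 v).indicator 1 z.1 * (Set.Icc 0 w).indicator 1 z.2) := by
    -- Measurability in $z$ is read off from a closed form of the integral.
    have e : (fun z : ℝ × ℝ => ∫ v in (0 : ℝ)..t, Real.exp (-(t - v)) *
        ((Set.Icc 0 v).indicator 1 z.1 * (Set.Icc 0 w).indicator 1 z.2)) =
        fun z => ((Set.Icc 0 t).indicator 1 z.1 - ouFun t z.1) *
          (Set.Icc 0 w).indicator 1 z.2 := by
      ext z
      simp_rw [← mul_assoc]
      rw [intervalIntegral.integral_mul_const, ouFun_eq ht.1]
      ring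
    rw [e]
    exact (((measurable_indicator_Icc t).comp measurable_fst).sub
      ((measurable_ouFun t).comp measurable_fst)).mul
      ((measurable_indicator_Icc w).comp measurable_snd)
  have h2 := (isFbmTensor_fbmInd H hT ht hw).add (hm t) (hmi.const_mul (-1)) (h1.const_smul (-1))
  have h3 := ((fbmTmul H T).flip (fbmInd H hT w)).intervalIntegral_comp_comm (μ := volume)
    (a := 0) (b := t) (f := fun v => Real.exp (-(t - v)) • fbmInd H hT v)
    (Continuous.intervalIntegrable (by fun_prop) _ _)
  simp only [ContinuousLinearMap.flip_apply, map_smul] at h3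
  convert h2 using 1
  · rw [ouElt, map_sub, sub_apply, ← h3, neg_one_smul, sub_eq_add_neg]
  · ext z
    simp_rw [← mul_assoc]
    rw [intervalIntegral.integral_mul_const, ouFun_eq ht.1]
    ring

theorem isFbmTensor_ouElt {t s : ℝ} (ht : t ∈ Set.Icc 0 T) (hs : s ∈ Set.Icc 0 T) :
    IsFbmTensor (fbmTmul H T (ouElt H hT t) (ouElt H hT s))
      (fun z => ouFun t z.1 * ouFun s z.2) := by
  have hc := continuous_fbmInd H hT
  have hm : ∀ w : ℝ, Measurable fun z : ℝ × ℝ =>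
      ouFun t z.1 * (Set.Icc 0 w).indicator (1 : ℝ → ℝ) z.2 := fun w =>
    ((measurable_ouFun t).comp measurable_fst).mul
      ((measurable_indicator_Icc w).comp measurable_snd)
  have h1 := IsFbmTensor.intervalIntegral (H := H) (T := T) (M := 1) hs.1
    (x := fun w => Real.exp (-(s - w)) • fbmTmul H T (ouElt H hT t) (fbmInd H hT w))
    (f := fun w z => Real.exp (-(s - w)) * (ouFun t z.1 * (Set.Icc 0 w).indicator 1 z.2))
    (Continuous.continuousOn (by fun_prop)) (fun v _ => (hm v).const_mul _)
    (fun w hw z => by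
      rw [abs_mul, abs_mul, Real.abs_exp]
      have e1 : Real.exp (-(s - w)) ≤ 1 := Real.exp_le_one_iff.2 (by linarith [hw.2])
      exact mul_le_one₀ e1 (by positivity) (mul_le_one₀ (abs_ouFun_le _ _)
        (abs_nonneg _) (abs_indicator_Icc_le _ _)))
    (fun z => by
      have h : ∀ᵐ w : ℝ, w ≠ z.2 := compl_mem_ae_iff.2 (measure_singleton _)
      filter_upwards [h] with w hw _
      exact ContinuousAt.mul (Continuous.continuousAt (by fun_prop))
        (continuousAt_const.mul
          (continuousAt_indicator_Icc (k := fun _ => 1) hw continuous_const)))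
    (fun w hw => (isFbmTensor_ouElt_fbmInd H hT ht ⟨hw.1, hw.2.trans hs.2⟩).const_smul _)
  have e : (fun z : ℝ × ℝ => ∫ w in (0 : ℝ)..s, Real.exp (-(s - w)) *
      (ouFun t z.1 * (Set.Icc 0 w).indicator 1 z.2)) =
      fun z => ouFun t z.1 * ((Set.Icc 0 s).indicator 1 z.2 - ouFun s z.2) := by
    ext z
    simp_rw [mul_left_comm _ (ouFun t z.1)]
    rw [intervalIntegral.integral_const_mul, ouFun_eq hs.1]
    ring
  rw [e] at h1
  have hmi : Measurable fun z : ℝ × ℝ =>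
      ouFun t z.1 * ((Set.Icc 0 s).indicator 1 z.2 - ouFun s z.2) :=
    ((measurable_ouFun t).comp measurable_fst).mul
      (((measurable_indicator_Icc s).comp measurable_snd).sub
        ((measurable_ouFun s).comp measurable_snd))
  have h2 := (isFbmTensor_ouElt_fbmInd H hT ht hs).add (hm s) (hmi.const_mul (-1))
    (h1.const_smul (-1))
  have h3 := (fbmTmul H T (ouElt H hT t)).intervalIntegral_comp_comm (μ := volume)
    (a := 0) (b := s) (f := fun v => Real.exp (-(s - v)) • fbmInd H hT v)
    (Continuous.intervalIntegrable (by fun_prop) _ _)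
  simp only [map_smul] at h3
  convert h2 using 1
  · rw [show ouElt H hT s = fbmInd H hT s -
      ∫ v in (0 : ℝ)..s, Real.exp (-(s - v)) • fbmInd H hT v from rfl, map_sub, ← h3,
      neg_one_smul, sub_eq_add_neg]
  · ext z
    ring

/-! ### The kernel as an element of the tensor square, and its norm -/

/-- The element of the tensor square given by `f_T`. -/
def expTensor (H : HurstParameter) {T : ℝ} (hT : 0 ≤ T) : FbmTensorSq H T :=
  fbmTmul H T (ouElt H hT T) (ouElt H hT T) +
    (2 : ℝ) • ∫ t in (0 : ℝ)..T, fbmTmul H T (ouElt H hT t) (ouElt H hT t)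

/-- For $a,b\in[0,T]$ the integrand is $e^{a+b-2t}$ from $t=\max(a,b)$ on, so twice the integral is
$e^{-|a-b|}-e^{a+b-2T}$; the boundary product restores the last term. -/
theorem integral_ouFun_mul {T : ℝ} (hT : 0 ≤ T) (z : ℝ × ℝ) :
    ouFun T z.1 * ouFun T z.2 + 2 * ∫ t in (0 : ℝ)..T, ouFun t z.1 * ouFun t z.2 =
      expKernel T z := by
  by_cases hz : z ∈ Set.Icc (0 : ℝ) T ×ˢ Set.Icc (0 : ℝ) T
  · obtain ⟨h1, h2⟩ := hz
    have h3 : ∀ t, ouFun t z.1 * ouFun t z.2 =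
        Real.exp (z.1 + z.2 - 2 * t) * (Set.Icc 0 t).indicator 1 (max z.1 z.2) := by
      intro t
      by_cases h : max z.1 z.2 ≤ t
      · rw [ouFun, ouFun,
          Set.indicator_of_mem (show z.1 ∈ Set.Icc 0 t from ⟨h1.1, (le_max_left _ _).trans h⟩),
          Set.indicator_of_mem (show z.2 ∈ Set.Icc 0 t from ⟨h2.1, (le_max_right _ _).trans h⟩),
          Set.indicator_of_mem (show max z.1 z.2 ∈ Set.Icc 0 t from
            ⟨h1.1.trans (le_max_left _ _), h⟩), ← Real.exp_add, Pi.one_apply,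
          mul_one]
        congr 1
        ring
      · rw [Set.indicator_of_notMem (fun h' => h h'.2), mul_zero, mul_eq_zero, ouFun, ouFun]
        rcases lt_max_iff.1 (not_le.1 h) with h' | h'
        · exact Or.inl (Set.indicator_of_notMem (fun h'' => h'.not_ge h''.2) _)
        · exact Or.inr (Set.indicator_of_notMem (fun h'' => h'.not_ge h''.2) _)
    have hmax : max z.1 z.2 ≤ T := max_le h1.2 h2.2
    have hmax0 : 0 ≤ max z.1 z.2 := h1.1.trans (le_max_left _ _)
    simp_rw [h3]
    have hd : ∀ t ∈ Set.uIcc (max z.1 z.2) T,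
        HasDerivAt (fun t => -(1 / 2) * Real.exp (z.1 + z.2 - 2 * t))
          (Real.exp (z.1 + z.2 - 2 * t)) t := fun t _ => by
      have := (((hasDerivAt_id t).const_mul 2).const_sub (z.1 + z.2)).exp.const_mul (-(1 / 2))
      refine this.congr_deriv ?_
      simp only [id]
      ring
    rw [integral_mul_indicator_Icc (by fun_prop) hmax0 hmax,
      intervalIntegral.integral_eq_sub_of_hasDerivAt hd
        (Continuous.intervalIntegrable (by fun_prop) _ _),
      Set.indicator_of_mem (show max z.1 z.2 ∈ Set.Icc 0 T from ⟨hmax0, hmax⟩), Pi.one_apply, expKernel,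
      Set.indicator_of_mem (Set.mk_mem_prod h1 h2)]
    have h4 : z.1 + z.2 - 2 * max z.1 z.2 = -|z.1 - z.2| := by
      rcases le_total z.1 z.2 with h | h
      · rw [max_eq_right h, abs_of_nonpos (by linarith)]
        ring
      · rw [max_eq_left h, abs_of_nonneg (by linarith)]
        ring
    rw [h4]
    ring
  · have h3 : ∀ t ∈ Set.uIcc 0 T, ouFun t z.1 * ouFun t z.2 = 0 := by
      intro t ht
      rw [Set.uIcc_of_le hT] at ht
      by_contra h
      rw [mul_eq_zero, not_or] at h
      have m1 := Set.mem_of_indicator_ne_zero h.1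
      have m2 := Set.mem_of_indicator_ne_zero h.2
      exact hz ⟨⟨m1.1, m1.2.trans ht.2⟩, ⟨m2.1, m2.2.trans ht.2⟩⟩
    rw [expKernel, Set.indicator_of_notMem hz, h3 T Set.right_mem_uIcc,
      intervalIntegral.integral_congr h3]
    simp

theorem measurable_expKernel (T : ℝ) : Measurable (expKernel T) :=
  Measurable.indicator (by fun_prop) (measurableSet_Icc.prod measurableSet_Icc)

theorem continuousOn_fbmTmul_ouElt :
    ContinuousOn (fun t => fbmTmul H T (ouElt H hT t) (ouElt H hT t)) (Set.Icc 0 T) := by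
  have h := continuousOn_ouElt H hT
  fun_prop

theorem isFbmTensor_expTensor : IsFbmTensor (expTensor H hT) (expKernel T) := by
  have hm : ∀ t : ℝ, Measurable fun z : ℝ × ℝ => ouFun t z.1 * ouFun t z.2 := fun t =>
    ((measurable_ouFun t).comp measurable_fst).mul ((measurable_ouFun t).comp measurable_snd)
  have h1 := IsFbmTensor.intervalIntegral (H := H) (T := T) (M := 1) hT
    (x := fun t => fbmTmul H T (ouElt H hT t) (ouElt H hT t))
    (f := fun t z => ouFun t z.1 * ouFun t z.2) (continuousOn_fbmTmul_ouElt H hT)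
    (fun t _ => hm t)
    (fun t _ z => by
      rw [abs_mul]
      exact mul_le_one₀ (abs_ouFun_le _ _) (abs_nonneg _) (abs_ouFun_le _ _))
    (fun z => by
      have h : ∀ s : ℝ, ∀ᵐ t : ℝ, t ≠ s := fun s => compl_mem_ae_iff.2 (measure_singleton _)
      filter_upwards [h z.1, h z.2] with t h1 h2 _
      exact (continuousAt_indicator_Icc (k := fun t s => Real.exp (-(t - s))) h1
        (by fun_prop)).mul (continuousAt_indicator_Icc (k := fun t s => Real.exp (-(t - s))) h2
        (by fun_prop)))
    (fun t ht => isFbmTensor_ouElt H hT ht ht)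
  have hmi : Measurable fun z : ℝ × ℝ => 2 * ∫ t in (0 : ℝ)..T, ouFun t z.1 * ouFun t z.2 := by
    have e : (fun z : ℝ × ℝ => 2 * ∫ t in (0 : ℝ)..T, ouFun t z.1 * ouFun t z.2) =
        fun z => expKernel T z - ouFun T z.1 * ouFun T z.2 := by
      ext z
      rw [← integral_ouFun_mul hT]
      ring
    rw [e]
    exact (measurable_expKernel T).sub (hm T)
  have h2 := (isFbmTensor_ouElt H hT ⟨hT, le_rfl⟩ ⟨hT, le_rfl⟩).add (hm T) hmi
    (h1.const_smul 2)
  simp_rw [integral_ouFun_mul hT] at h2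
  exact h2

/-- Bilinear expansion with $\langle u_t\otimes u_t,u_s\otimes u_s\rangle=\rho(t,s)^2$. The first
$4$ in `ouNormSq` is twice the cross term with its coefficient $2$, the second is $2^2$. -/
theorem norm_expTensor_sq : ‖expTensor H hT‖ ^ 2 = ouNormSq H T := by
  set G := fun t => fbmTmul H T (ouElt H hT t) (ouElt H hT t) with hG
  have hi : IntervalIntegrable G volume 0 T := by
    refine ContinuousOn.intervalIntegrable ?_
    rw [Set.uIcc_of_le hT]
    exact continuousOn_fbmTmul_ouElt H hT
  have hTT : T ∈ Set.Icc 0 T := ⟨hT, le_rfl⟩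
  have hGG : ∀ t ∈ Set.Icc 0 T, ∀ s ∈ Set.Icc 0 T, inner ℝ (G t) (G s) = ouCovZero H t s ^ 2 :=
    fun t ht s hs => by rw [hG, inner_fbmTmul, inner_ouElt H hT ht hs, sq]
  have hint : ∀ y, inner ℝ y (∫ t in (0 : ℝ)..T, G t) = ∫ t in (0 : ℝ)..T, inner ℝ y (G t) :=
    fun y => by
      have h := (innerSL ℝ y).intervalIntegral_comp_comm (μ := volume) (f := G) hi
      simp only [innerSL_apply_apply] at h
      exact h.symm
  have h1 : ∀ t ∈ Set.Icc 0 T, inner ℝ (G t) (∫ s in (0 : ℝ)..T, G s) =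
      ∫ s in (0 : ℝ)..T, ouCovZero H t s ^ 2 := fun t ht => by
    rw [hint]
    refine intervalIntegral.integral_congr fun s hs => ?_
    rw [Set.uIcc_of_le hT] at hs
    exact hGG t ht s hs
  have h2 : inner ℝ (∫ t in (0 : ℝ)..T, G t) (∫ s in (0 : ℝ)..T, G s) =
      ∫ t in (0 : ℝ)..T, ∫ s in (0 : ℝ)..T, ouCovZero H t s ^ 2 := by
    rw [hint]
    refine intervalIntegral.integral_congr fun t ht => ?_
    rw [Set.uIcc_of_le hT] at ht
    rw [real_inner_comm, h1 t ht]
  rw [expTensor, norm_add_sq_real, ← real_inner_self_eq_norm_sq, ← real_inner_self_eq_norm_sq,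
    inner_smul_left, inner_smul_right, inner_smul_right]
  have h3 := hGG T hTT T hTT
  have h4 := h1 T hTT
  simp only [hG] at h2 h3 h4
  rw [h2, h3, h4, ouNormSq]
  simp only [conj_trivial]
  ring

theorem existsUnique_isFbmTensor_expKernel {T : ℝ} (hT : 0 ≤ T) :
    ∃! x : FbmTensorSq H T, IsFbmTensor x (expKernel T) :=
  ⟨expTensor H hT, isFbmTensor_expTensor H hT, fun _ hy =>
    hy.unique (measurable_expKernel T).aestronglyMeasurable (isFbmTensor_expTensor H hT)⟩

theorem fbmTensorNorm_expKernel_sq {T : ℝ} (hT : 0 ≤ T) :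
    fbmTensorNorm H T (expKernel T) ^ 2 = ouNormSq H T := by
  have h : ∃ x : FbmTensorSq H T, IsFbmTensor x (expKernel T) :=
    ⟨_, isFbmTensor_expTensor H hT⟩
  rw [fbmTensorNorm, dif_pos h, h.choose_spec.unique
    (measurable_expKernel T).aestronglyMeasurable (isFbmTensor_expTensor H hT),
    norm_expTensor_sq]

end


end

theorem mainTheorem4 (H : HurstParameter) :
    (∀ T : ℝ, 0 < T → ∃! x : FbmTensorSq H T, IsFbmTensor x (expKernel T)) ∧
    ((∃ l : ℝ, Tendsto (fun T : ℝ => 1 / (2 * T) * fbmTensorNorm H T (expKernel T) ^ 2)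
      atTop (𝓝 l)) ↔ (H : ℝ) ∈ Set.Ioo (0 : ℝ) (3 / 4)) ∧
    ((H : ℝ) ∈ Set.Ioo (0 : ℝ) (3 / 4) →
      Tendsto (fun T : ℝ => 1 / (2 * T) * fbmTensorNorm H T (expKernel T) ^ 2)
        atTop (𝓝 (sigmaSq H))) := by
  have hev : (fun T : ℝ => 1 / (2 * T) * fbmTensorNorm H T (expKernel T) ^ 2) =ᶠ[atTop]
      fun T : ℝ => 1 / (2 * T) * ouNormSq H T := by
    filter_upwards [eventually_ge_atTop 0] with T hT
    rw [fbmTensorNorm_expKernel_sq H hT]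
  have hlim : (H : ℝ) ∈ Set.Ioo (0 : ℝ) (3 / 4) →
      Tendsto (fun T : ℝ => 1 / (2 * T) * fbmTensorNorm H T (expKernel T) ^ 2)
        atTop (𝓝 (sigmaSq H)) := fun h => (tendsto_ouNormSq H h.2).congr' hev.symm
  refine ⟨fun T hT => existsUnique_isFbmTensor_expKernel H hT.le, ⟨?_, fun h => ⟨_, hlim h⟩⟩, hlim⟩
  rintro ⟨l, hl⟩
  refine ⟨H.2.1, not_le.1 fun h => ?_⟩
  exact not_tendsto_ouNormSq H h l (hl.congr' hev)
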